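/- Let $N\ge 2$, $\varepsilon>0$, and let $\alpha\in\mathbb R$ not be a non-zero even integer (in particular every $\alpha\in[0,2)$ is allowed). Write points of $\mathbb R^{2N}$ as $(\mathbf x_1,\dots,\mathbf x_N)$ with $\mathbf x_j=(x_j,y_j)\in\mathbb R^2$, let $(x,y)^\perp=(-y,x)$, and put $$\mathbf A_j=\sum_{k\ne j}\frac{(\mathbf x_j-\mathbf x_k)^\perp}{|\mathbf x_j-\mathbf x_k|^2},\qquad D_j=-\mathrm i\nabla_{\mathbf x_j}+\alpha\mathbf A_j,\qquad V_\varepsilon(x,y)=x^2+\frac{y^2}{\varepsilon^2}.$$ Let $L^2_{\mathrm{sym}}(\mathbb R^{2N})$ be the space of complex-valued $L^2$ functions that are invariant under permutations of $\mathbf x_1,\dots,\mathbf x_N$, and let $\mathcal C$ be the space of permutation-invariant functions in $C_c^\infty(\mathbb R^{2N}\setminus\mathbb D)$, where $\mathbb D=\{\mathbf x_j=\mathbf x_l\text{ for some }j\neq l\}$. Let $H^{2D}_\varepsilon$ be the Friedrichs extension on $L^2_{\mathrm{sym}}(\mathbb R^{2N})$ of $\sum_{j=1}^N\left(D_j^2+V_\varepsilon(\mathbf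 x_j)\right)$ defined on $\mathcal C$. Its quadratic form domain $\mathcal D_q(H^{2D}_\varepsilon)$ is the domain of the closure of the form $$\mathcal E(\phi)=\sum_{j=1}^N\int_{\mathbb R^{2N}}\left(|D_j\phi|^2+V_\varepsilon(\mathbf x_j)|\phi|^2\right),\qquad \phi\in\mathcal C,$$ i.e. the completion of $\mathcal C$, inside $L^2$, under the norm $\sqrt{\mathcal E(\cdot)}+\|\cdot\|_{L^2}$. Then $$\mathcal D_q(H^{2D}_\varepsilon)\subset H^1_V(\mathbb R^{2N}):=\left\{\phi\in H^1(\mathbb R^{2N}) : |\mathbf x_j|\phi\in L^2(\mathbb R^{2N})\text{ for all }j\right\}.$$ Moreover $H^{2D}_\varepsilon$ has compact resolvent: $H^{2D}_\varepsilon+1$ is a bijection from the domain of $H^{2D}_\varepsilon$ onto $L^2_{\mathrm{sym}}(\mathbb R^{2N})$, and its inverse is a compact operator on $L^2_{\mathrm{sym}}(\mathbb R^{2N})$. -/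

import Mathlib

open MeasureTheory Filter Topology
open scoped ContDiff ComplexConjugate

noncomputable section

namespace Anyon

/-- The plane `ℝ²` with its Euclidean norm. -/
abbrev Plane : Type := EuclideanSpace ℝ (Fin 2)

/-- Configurations `(x₁, …, x_N)` of `N` points of the plane, that is `ℝ^{2N}`; its `volume` is
Lebesgue measure. -/
abbrev Config (N : ℕ) : Type := Fin N → Plane

/-- `L²(ℝ^{2N}; ℂ)`. -/
abbrev L2 (N : ℕ) : Type := Lp ℂ 2 (volume : Measure (Config N))

/-- `(x, y)^⊥ = (-y, x)`. -/
def perp (v : Plane) : Plane := !₂[-v 1, v 0]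

/-- The set of configurations in which two particles coincide. -/
def diagonal (N : ℕ) : Set (Config N) := {x | ∃ j l, j ≠ l ∧ x j = x l}

/-- The vector potential `A_j = ∑_{k ≠ j} (x_j - x_k)^⊥ / |x_j - x_k|²`. -/
def vectorPotential {N : ℕ} (j : Fin N) (x : Config N) : Plane :=
  ∑ k ∈ Finset.univ.erase j, (‖x j - x k‖ ^ 2)⁻¹ • perp (x j - x k)

/-- The anisotropic harmonic trap `V_ε(x, y) = x² + y² / ε²`. -/
def trap (ε : ℝ) (v : Plane) : ℝ := v 0 ^ 2 + v 1 ^ 2 / ε ^ 2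

/-- The unit vector of `ℝ^{2N}` along the `a`-th coordinate of the `j`-th particle. -/
def unitVec {N : ℕ} (j : Fin N) (a : Fin 2) : Config N :=
  Pi.single j (EuclideanSpace.single a 1)

/-- The classical partial derivative in the `a`-th coordinate of the `j`-th particle. -/
def partialDeriv {N : ℕ} (j : Fin N) (a : Fin 2) (φ : Config N → ℂ) (x : Config N) : ℂ :=
  fderiv ℝ φ x (unitVec j a)

/-- The `a`-th component of `D_j φ = (-i ∇_{x_j} + α A_j) φ`. -/
def magneticDeriv {N : ℕ} (α : ℝ) (j : Fin N) (a : Fin 2) (φ : Config N → ℂ) (x : Config N) : ℂ :=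
  -Complex.I * partialDeriv j a φ x + ((α * vectorPotential j x a : ℝ) : ℂ) * φ x

/-- The core: smooth functions, invariant under permutations of the particles, whose support is a
compact subset of the complement of the diagonals. -/
structure IsCore {N : ℕ} (φ : Config N → ℂ) : Prop where
  smooth : ContDiff ℝ ∞ φ
  compact : HasCompactSupport φ
  support : tsupport φ ⊆ (diagonal N)ᶜ
  symm : ∀ (σ : Equiv.Perm (Fin N)) (x : Config N), φ (x ∘ σ) = φ x

/-- The quadratic form `∑_j ∫ (|D_j φ|² + V_ε(x_j) |φ|²)`, to be used on the core. -/
def energy {N : ℕ} (α ε : ℝ) (φ : Config N → ℂ) : ℝ :=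
  ∑ j : Fin N, ∫ x, ((∑ a : Fin 2, ‖magneticDeriv α j a φ x‖ ^ 2) + trap ε (x j) * ‖φ x‖ ^ 2)

/-- The differential operator `∑_j (D_j² + V_ε(x_j))`, to be used on the core. -/
def hamiltonian {N : ℕ} (α ε : ℝ) (φ : Config N → ℂ) (x : Config N) : ℂ :=
  ∑ j : Fin N, ((∑ a : Fin 2, magneticDeriv α j a (magneticDeriv α j a φ) x)
    + (trap ε (x j) : ℂ) * φ x)

/-- The domain of the closure of the quadratic form `energy α ε` on the core: the `L²`-limits of
sequences in the core that are Cauchy for the form norm. -/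
def formDomain (N : ℕ) (α ε : ℝ) : Set (L2 N) :=
  {φ | ∃ u : ℕ → Config N → ℂ, (∀ n, IsCore (u n)) ∧
    (∀ δ > 0, ∃ n₀, ∀ m ≥ n₀, ∀ n ≥ n₀, energy α ε (u m - u n) < δ) ∧
    Tendsto (fun n => eLpNorm (fun x => u n x - φ x) 2 volume) atTop (𝓝 0)}

/-- `g` is the weak (distributional) partial derivative of `φ` in the `a`-th coordinate of the
`j`-th particle, on all of `ℝ^{2N}`. -/
def IsWeakPartial {N : ℕ} (j : Fin N) (a : Fin 2) (φ g : L2 N) : Prop :=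
  ∀ ψ : Config N → ℂ, ContDiff ℝ ∞ ψ → HasCompactSupport ψ →
    ∫ x, φ x * partialDeriv j a ψ x = -∫ x, g x * ψ x

/-- The Sobolev space `H¹(ℝ^{2N})`. -/
def sobolevH1 (N : ℕ) : Set (L2 N) :=
  {φ | ∀ (j : Fin N) (a : Fin 2), ∃ g : L2 N, IsWeakPartial j a φ g}

/-- `H¹_V(ℝ^{2N})`: the `φ ∈ H¹(ℝ^{2N})` with `|x_j| φ ∈ L²` for all `j`. -/
def sobolevH1V (N : ℕ) : Set (L2 N) :=
  {φ | φ ∈ sobolevH1 N ∧ ∀ j : Fin N, MemLp (fun x => (‖x j‖ : ℂ) * φ x) 2 volume}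

theorem measurePreserving_perm {N : ℕ} (σ : Equiv.Perm (Fin N)) :
    MeasurePreserving (fun x : Config N => x ∘ σ) volume volume := by
  convert volume_measurePreserving_piCongrLeft (fun _ : Fin N => Plane) σ.symm using 1
  funext x i
  simp [MeasurableEquiv.coe_piCongrLeft, Equiv.piCongrLeft, Equiv.piCongrLeft']

/-- `L²_sym(ℝ^{2N})`: the square-integrable functions that are invariant under permutations of the
particles. -/
def L2sym (N : ℕ) : Submodule ℂ (L2 N) where
  carrier := {φ | ∀ σ : Equiv.Perm (Fin N), (fun x => φ (x ∘ σ)) =ᵐ[volume] φ}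
  zero_mem' := by
    intro σ
    have h := Lp.coeFn_zero ℂ 2 (volume : Measure (Config N))
    filter_upwards [h, (measurePreserving_perm σ).quasiMeasurePreserving.ae_eq_comp h]
      with x h1 h2
    exact h2.trans h1.symm
  add_mem' := by
    intro φ ψ hφ hψ σ
    have h := Lp.coeFn_add φ ψ
    filter_upwards [h, (measurePreserving_perm σ).quasiMeasurePreserving.ae_eq_comp h,
      hφ σ, hψ σ] with x h1 h2 h3 h4
    simp only [Function.comp_apply, Pi.add_apply] at h1 h2 h3 h4 ⊢
    rw [h1, h2, h3, h4]
  smul_mem' := by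
    intro c φ hφ σ
    have h := Lp.coeFn_smul c φ
    filter_upwards [h, (measurePreserving_perm σ).quasiMeasurePreserving.ae_eq_comp h, hφ σ]
      with x h1 h2 h3
    simp only [Function.comp_apply, Pi.smul_apply] at h1 h2 h3 ⊢
    rw [h1, h2, h3]

/-- The graph `{(φ, H φ)}` of the Friedrichs extension `H` of `hamiltonian α ε` on the core: the
restriction of the adjoint of this symmetric operator on `L²_sym` to the form domain. -/
def friedrichsGraph (N : ℕ) (α ε : ℝ) : Set (L2sym N × L2sym N) :=
  {p | (p.1 : L2 N) ∈ formDomain N α ε ∧ ∀ v : Config N → ℂ, IsCore v →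
    ∫ x, conj ((p.1 : L2 N) x) * hamiltonian α ε v x = ∫ x, conj ((p.2 : L2 N) x) * v x}

/-- `R` is the inverse of `H + 1`, where `H` is the operator with the given graph: for all `φ`
and `f`, `φ` is in the domain of `H` with `H φ + φ = f` if and only if `φ = R f`. -/
def IsResolventAtNegOne {N : ℕ} (graph : Set (L2sym N × L2sym N))
    (R : L2sym N →L[ℂ] L2sym N) : Prop :=
  ∀ φ f : L2sym N, (φ, f - φ) ∈ graph ↔ φ = R f

end Anyon

end

/-!
Rotating the pair `x_j, x_k` by `π` about its midpoint exchanges the two particles, and as long as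
no other particle lies in the disc swept out, the vector potential along the rotation is `α` times
the differential of an angle, with total increment `π`. Gauging it away turns a symmetric function
into one that picks up the phase `e^{iπα}`. For `α = 0` there is no vector potential to control;
otherwise the phase differs from `1`, so that a Poincaré inequality in the angle holds. This is the
Hardy inequality `|x_j - x_k|⁻² ≲ ∑ D_j²` on the configurations where the pair is alone. If a third
particle `x_l` is close, `|x_j - x_k|⁻²` is comparable to the inverse square distance to the
coincidence of all three, and the Hardy inequality in the four relative dimensions applies
irrespective of the magnetic field. Hence `|A_j| φ`, and with it `∇φ`, is controlled by the magnetic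
energy, so the form domain lies in `H¹`. Compactness of the resolvent follows from the Riesz
representation in the form domain and a Rellich argument.
-/

noncomputable section

theorem eLpNorm_two_sq {X F : Type*} [MeasurableSpace X] [NormedAddCommGroup F] (f : X → F)
    (μ : Measure X) : eLpNorm f 2 μ ^ 2 = ∫⁻ x, ‖f x‖ₑ ^ 2 ∂μ := by
  simpa using eLpNorm_nnreal_pow_eq_lintegral (f := f) (μ := μ) (p := 2) (by simp)

theorem sq_lintegral_le {X : Type*} [MeasurableSpace X] {μ : Measure X} {f : X → ENNReal}
    (hf : AEMeasurable f μ) : (∫⁻ x, f x ∂μ) ^ 2 ≤ μ Set.univ * ∫⁻ x, f x ^ 2 ∂μ := by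
  have hölder : ∫⁻ x, f x ∂μ ≤ (∫⁻ x, f x ^ 2 ∂μ) ^ (1 / 2 : ℝ) * μ Set.univ ^ (1 / 2 : ℝ) := by
    simpa using ENNReal.lintegral_mul_le_Lp_mul_Lq μ Real.HolderConjugate.two_two hf
      (aemeasurable_const (b := (1 : ENNReal)))
  have sq_sqrt : ∀ a : ENNReal, (a ^ (1 / 2 : ℝ)) ^ 2 = a := fun a => by
    rw [← ENNReal.rpow_natCast, ← ENNReal.rpow_mul]
    norm_num
  calc (∫⁻ x, f x ∂μ) ^ 2
      ≤ ((∫⁻ x, f x ^ 2 ∂μ) ^ (1 / 2 : ℝ) * μ Set.univ ^ (1 / 2 : ℝ)) ^ 2 := by gcongr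
    _ = μ Set.univ * ∫⁻ x, f x ^ 2 ∂μ := by rw [mul_pow, sq_sqrt, sq_sqrt, mul_comm]

theorem sq_sum_le {ι : Type*} (s : Finset ι) (f : ι → ENNReal) :
    (∑ i ∈ s, f i) ^ 2 ≤ s.card * ∑ i ∈ s, f i ^ 2 := by
  have h := ENNReal.rpow_sum_le_const_mul_sum_rpow s f (p := 2) one_le_two
  norm_num at h
  exact_mod_cast h

theorem pi_norm_sq_le_sum {ι E : Type*} [Fintype ι] [SeminormedAddCommGroup E] (x : ι → E) :
    ‖x‖ ^ 2 ≤ ∑ i, ‖x i‖ ^ 2 := by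
  rw [← Real.le_sqrt (norm_nonneg _) (by positivity), pi_norm_le_iff_of_nonneg (by positivity)]
  exact fun i => Real.le_sqrt_of_sq_le <|
    Finset.single_le_sum (f := fun i => ‖x i‖ ^ 2) (fun _ _ => sq_nonneg _) (Finset.mem_univ i)

theorem norm_le_mul_norm_of_enorm_sq_le {E F : Type*} [SeminormedAddCommGroup E]
    [SeminormedAddCommGroup F] {x : E} {y : F} {C : NNReal}
    (h : ‖x‖ₑ ^ 2 ≤ (C * ‖y‖ₑ) ^ 2) : ‖x‖ ≤ C * ‖y‖ := by
  rw [ENNReal.pow_le_pow_left_iff two_ne_zero, enorm_eq_nnnorm, enorm_eq_nnnorm] at h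
  exact_mod_cast (ENNReal.coe_le_coe.1 (by rwa [ENNReal.coe_mul]) : ‖x‖₊ ≤ C * ‖y‖₊)

theorem enorm_integral_sq_le {X F : Type*} [MeasurableSpace X] {μ : Measure X}
    [NormedAddCommGroup F] [NormedSpace ℝ F] {f : X → F} (hf : AEStronglyMeasurable f μ) :
    ‖∫ x, f x ∂μ‖ₑ ^ 2 ≤ μ Set.univ * ∫⁻ x, ‖f x‖ₑ ^ 2 ∂μ :=
  (pow_le_pow_left₀ zero_le (enorm_integral_le_lintegral_enorm f) 2).trans
    (sq_lintegral_le hf.enorm)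

section Poincare

variable {F : Type*} [NormedAddCommGroup F] [NormedSpace ℝ F] [CompleteSpace F]

theorem enorm_sub_le_lintegral_enorm_deriv {f f' : ℝ → F} {a b : ℝ}
    (hf : ∀ t, HasDerivAt f (f' t) t) (hf' : Continuous f') {s t : ℝ} (hs : s ∈ Set.Icc a b)
    (ht : t ∈ Set.Icc a b) : ‖f t - f s‖ₑ ≤ ∫⁻ r in Set.Ioc a b, ‖f' r‖ₑ := by
  have hsub : Set.uIoc s t ⊆ Set.Ioc a b :=
    Set.Ioc_subset_Ioc (le_min hs.1 ht.1) (max_le hs.2 ht.2)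
  rw [← intervalIntegral.integral_eq_sub_of_hasDerivAt (fun r _ => hf r)
    (hf'.intervalIntegrable s t), ← ofReal_norm, intervalIntegral.norm_intervalIntegral_eq,
    ofReal_norm]
  exact (enorm_integral_le_lintegral_enorm _).trans (lintegral_mono_set hsub)

/- Since `f a = (κ - 1)⁻¹ (f b - f a)`, the boundary condition replaces the vanishing mean of the
usual Poincaré inequality. -/
theorem lintegral_enorm_sq_le_of_apply_eq_smul {𝕜 : Type*} [NormedField 𝕜] [NormedSpace 𝕜 F]
    {f f' : ℝ → F} {a b : ℝ} {κ : 𝕜} (hab : a ≤ b) (hf : ∀ t, HasDerivAt f (f' t) t)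
    (hf' : Continuous f') (hκ : κ ≠ 1) (hbc : f b = κ • f a) :
    ∫⁻ t in Set.Ioc a b, ‖f t‖ₑ ^ 2 ≤
      ((1 + ‖(κ - 1)⁻¹‖ₑ) * ENNReal.ofReal (b - a)) ^ 2 * ∫⁻ t in Set.Ioc a b, ‖f' t‖ₑ ^ 2 := by
  set L := ∫⁻ t in Set.Ioc a b, ‖f' t‖ₑ
  have ha : f a = (κ - 1)⁻¹ • (f b - f a) := by
    rw [eq_inv_smul_iff₀ (sub_ne_zero.2 hκ), sub_smul, one_smul, hbc]
  have hbound : ∀ t ∈ Set.Icc a b, ‖f t‖ₑ ≤ (1 + ‖(κ - 1)⁻¹‖ₑ) * L := fun t ht => by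
    have hta := enorm_sub_le_lintegral_enorm_deriv hf hf' (Set.left_mem_Icc.2 hab) ht
    have hba := enorm_sub_le_lintegral_enorm_deriv hf hf' (Set.left_mem_Icc.2 hab)
      (Set.right_mem_Icc.2 hab)
    calc ‖f t‖ₑ = ‖(f t - f a) + f a‖ₑ := by rw [sub_add_cancel]
      _ ≤ ‖f t - f a‖ₑ + ‖f a‖ₑ := enorm_add_le _ _
      _ = ‖f t - f a‖ₑ + ‖(κ - 1)⁻¹‖ₑ * ‖f b - f a‖ₑ := by rw [← enorm_smul, ← ha]
      _ ≤ L + ‖(κ - 1)⁻¹‖ₑ * L := by gcongr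
      _ = (1 + ‖(κ - 1)⁻¹‖ₑ) * L := by ring
  have hL : L ^ 2 ≤ ENNReal.ofReal (b - a) * ∫⁻ t in Set.Ioc a b, ‖f' t‖ₑ ^ 2 := by
    simpa using sq_lintegral_le (μ := volume.restrict (Set.Ioc a b)) hf'.enorm.aemeasurable
  calc ∫⁻ t in Set.Ioc a b, ‖f t‖ₑ ^ 2
      ≤ ∫⁻ _ in Set.Ioc a b, ((1 + ‖(κ - 1)⁻¹‖ₑ) * L) ^ 2 :=
        setLIntegral_mono' measurableSet_Ioc fun t ht => by
          gcongr
          exact hbound t (Set.Ioc_subset_Icc_self ht)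
    _ = (1 + ‖(κ - 1)⁻¹‖ₑ) ^ 2 * L ^ 2 * ENNReal.ofReal (b - a) := by simp [mul_pow]
    _ ≤ (1 + ‖(κ - 1)⁻¹‖ₑ) ^ 2 * (ENNReal.ofReal (b - a) * ∫⁻ t in Set.Ioc a b, ‖f' t‖ₑ ^ 2) *
          ENNReal.ofReal (b - a) := by gcongr
    _ = _ := by ring

end Poincare

theorem lintegral_le_of_lintegral_comp_le {X Θ : Type*} [MeasurableSpace X] [MeasurableSpace Θ]
    {μ : Measure X} [SFinite μ] {ν : Measure Θ} [IsFiniteMeasure ν] [NeZero ν] {T : Θ → X → X}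
    (hT : Measurable (Function.uncurry T)) (hμ : ∀ θ, MeasurePreserving (T θ) μ μ)
    {f g : X → ENNReal} (hf : Measurable f) (hg : Measurable g)
    (h : ∀ x, ∫⁻ θ, f (T θ x) ∂ν ≤ ∫⁻ θ, g (T θ x) ∂ν) : ∫⁻ x, f x ∂μ ≤ ∫⁻ x, g x ∂μ := by
  have average : ∀ k : X → ENNReal, Measurable k →
      ∫⁻ x, ∫⁻ θ, k (T θ x) ∂ν ∂μ = (∫⁻ x, k x ∂μ) * ν Set.univ := fun k hk => by
    rw [lintegral_lintegral_swap (f := fun x θ => k (T θ x))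
      (hk.comp (hT.comp measurable_swap)).aemeasurable]
    simp [fun θ => (hμ θ).lintegral_comp hk]
  have key := lintegral_mono (μ := μ) h
  rw [average f hf, average g hg] at key
  exact (ENNReal.mul_le_mul_iff_left (NeZero.ne _) (measure_ne_top ν _)).1 key

section Mesh

variable {E : Type*} [NormedAddCommGroup E] [MeasurableSpace E]

/-- A finite family of disjoint cells of radius at most `r` whose volumes are, up to the factor `C`,
at least that of a ball of radius `r`: the mesh on which Rellich's theorem replaces a function by a
step function. -/
structure IsMesh (μ : Measure E) (C : NNReal) (r : ℝ) (𝒬 : Finset (Set E)) : Prop where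
  measurableSet : ∀ Q ∈ 𝒬, MeasurableSet Q
  pairwiseDisjoint : (𝒬 : Set (Set E)).Pairwise Disjoint
  subset_closedBall : ∀ Q ∈ 𝒬, ∀ x ∈ Q, Q ⊆ Metric.closedBall x r
  measure_closedBall_le : ∀ Q ∈ 𝒬, μ (Metric.closedBall 0 r) ≤ C * μ Q

variable {μ : Measure E} {C : NNReal} {r : ℝ} {𝒬 : Finset (Set E)} {Q : Set E}

theorem IsMesh.measure_ne_top [IsFiniteMeasureOnCompacts μ] [ProperSpace E] (h : IsMesh μ C r 𝒬)
    (hQ : Q ∈ 𝒬) : μ Q ≠ ⊤ := by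
  rcases Q.eq_empty_or_nonempty with rfl | ⟨x, hx⟩
  · simp
  · exact ((measure_mono (h.subset_closedBall Q hQ x hx)).trans_lt measure_closedBall_lt_top).ne

theorem IsMesh.measure_ne_zero [μ.IsOpenPosMeasure] (h : IsMesh μ C r 𝒬) (hr : 0 < r)
    (hQ : Q ∈ 𝒬) : μ Q ≠ 0 := fun h0 =>
  (Metric.measure_closedBall_pos μ (0 : E) hr).not_ge (by
    simpa [h0] using h.measure_closedBall_le Q hQ)

theorem IsMesh.lintegral_enorm_sub_sum_indicator_sq {F : Type*} [NormedAddCommGroup F]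
    (h : IsMesh μ C r 𝒬) (u : E → F) (c : Set E → F) :
    ∫⁻ x, ‖u x - ∑ Q ∈ 𝒬, Q.indicator (fun _ => c Q) x‖ₑ ^ 2 ∂μ =
      ∑ Q ∈ 𝒬, ∫⁻ x in Q, ‖u x - c Q‖ₑ ^ 2 ∂μ + ∫⁻ x in (⋃ Q ∈ 𝒬, Q)ᶜ, ‖u x‖ₑ ^ 2 ∂μ := by
  have hmeas : MeasurableSet (⋃ Q ∈ 𝒬, Q) := 𝒬.measurableSet_biUnion h.measurableSet
  have hin : ∀ Q ∈ 𝒬, ∀ x ∈ Q, ∑ P ∈ 𝒬, P.indicator (fun _ => c P) x = c Q := fun Q hQ x hx => by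
    rw [Finset.sum_eq_single_of_mem Q hQ, Set.indicator_of_mem hx]
    exact fun P hP hne => Set.indicator_of_notMem
      (Set.disjoint_right.1 (h.pairwiseDisjoint hP hQ hne) hx) _
  have hout : ∀ x ∈ (⋃ Q ∈ 𝒬, Q)ᶜ, ∑ P ∈ 𝒬, P.indicator (fun _ => c P) x = 0 := fun x hx =>
    Finset.sum_eq_zero fun P hP => Set.indicator_of_notMem
      (fun hxP => hx (Set.mem_biUnion hP hxP)) _
  rw [← lintegral_add_compl _ hmeas,
    lintegral_biUnion_finset (t := fun Q => Q) h.pairwiseDisjoint h.measurableSet]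
  congr 1
  · exact Finset.sum_congr rfl fun Q hQ =>
      setLIntegral_congr_fun (h.measurableSet Q hQ) fun x hx => by rw [hin Q hQ x hx]
  · exact setLIntegral_congr_fun hmeas.compl fun x hx => by rw [hout x hx, sub_zero]

theorem IsMesh.exists_finiteDimensional_stepFunctions [IsFiniteMeasureOnCompacts μ]
    [ProperSpace E] (𝕜 : Type*) [RCLike 𝕜] (h : IsMesh μ C r 𝒬) :
    ∃ V : Submodule 𝕜 (Lp 𝕜 2 μ), FiniteDimensional 𝕜 V ∧ ∀ c : Set E → 𝕜, ∃ w ∈ V,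
      w =ᵐ[μ] fun x => ∑ Q ∈ 𝒬, Q.indicator (fun _ => c Q) x := by
  let e : 𝒬 → Lp 𝕜 2 μ := fun Q =>
    indicatorConstLp 2 (h.measurableSet Q Q.2) (h.measure_ne_top Q.2) 1
  refine ⟨Submodule.span 𝕜 (Set.range e), FiniteDimensional.span_of_finite 𝕜 (Set.finite_range e),
    fun c => ⟨∑ Q : 𝒬, c Q • e Q, Submodule.sum_mem _ fun Q _ =>
      Submodule.smul_mem _ _ (Submodule.subset_span ⟨Q, rfl⟩), ?_⟩⟩
  have hterm : ∀ Q : 𝒬, c Q • e Q =ᵐ[μ] (Q : Set E).indicator fun _ => c Q := fun Q => by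
    filter_upwards [Lp.coeFn_smul (c Q) (e Q), indicatorConstLp_coeFn (p := 2)
      (hs := h.measurableSet Q Q.2) (hμs := h.measure_ne_top Q.2) (c := (1 : 𝕜))] with x h1 h2
    rw [h1, Pi.smul_apply, h2, ← Set.indicator_const_smul_apply, smul_eq_mul, mul_one]
  filter_upwards [Lp.coeFn_finsetSum Finset.univ fun Q : 𝒬 => c Q • e Q, ae_all_iff.2 hterm]
    with x hsum hx
  rw [hsum, Finset.sum_apply, ← Finset.sum_coe_sort 𝒬]
  exact Finset.sum_congr rfl fun Q _ => hx Q

end Mesh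

section LatticeCell

variable {E : Type*} [NormedAddCommGroup E] [NormedSpace ℝ E] {ι : Type*}

/-- The translate by `k` of the fundamental domain of the lattice spanned by `b`, scaled by `t`. -/
def latticeCell (b : Module.Basis ι ℝ E) (t : ℝ) (k : E) : Set E :=
  {x | t⁻¹ • x - k ∈ ZSpan.fundamentalDomain b}

theorem existsUnique_mem_latticeCell [Finite ι] (b : Module.Basis ι ℝ E) (t : ℝ)
    (x : E) : ∃! k, k ∈ Submodule.span ℤ (Set.range b) ∧ x ∈ latticeCell b t k := by
  obtain ⟨v, hv, huniq⟩ := ZSpan.exist_unique_vadd_mem_fundamentalDomain b (t⁻¹ • x)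
  refine ⟨-v, ⟨neg_mem v.2, show t⁻¹ • x - -(v : E) ∈ _ by rwa [sub_neg_eq_add, add_comm]⟩,
    fun k ⟨hk, hx⟩ => ?_⟩
  have := huniq ⟨-k, neg_mem hk⟩ (show -k + t⁻¹ • x ∈ _ by rwa [neg_add_eq_sub])
  rw [← this, neg_neg]

section Bounded

variable {b : Module.Basis ι ℝ E} {M t : ℝ} {k x : E}

theorem latticeCell_subset_closedBall (hb : ∀ y ∈ ZSpan.fundamentalDomain b, ‖y‖ ≤ M) (ht : 0 < t)
    (hx : x ∈ latticeCell b t k) : latticeCell b t k ⊆ Metric.closedBall x (t * (2 * M)) := by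
  intro y hy
  have hdist : ‖t⁻¹ • (y - x)‖ ≤ 2 * M := by
    calc ‖t⁻¹ • (y - x)‖ = ‖(t⁻¹ • y - k) - (t⁻¹ • x - k)‖ := by
          rw [smul_sub, sub_sub_sub_cancel_right]
      _ ≤ M + M := (norm_sub_le _ _).trans (add_le_add (hb _ hy) (hb _ hx))
      _ = 2 * M := (two_mul M).symm
  rwa [norm_smul, norm_inv, Real.norm_of_nonneg ht.le, inv_mul_le_iff₀ ht,
    ← mem_closedBall_iff_norm] at hdist

theorem norm_le_of_mem_latticeCell (hb : ∀ y ∈ ZSpan.fundamentalDomain b, ‖y‖ ≤ M) (ht : 0 < t)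
    (hx : x ∈ latticeCell b t k) : ‖k‖ ≤ t⁻¹ * ‖x‖ + M := by
  calc ‖k‖ = ‖t⁻¹ • x - (t⁻¹ • x - k)‖ := by rw [sub_sub_cancel]
    _ ≤ ‖t⁻¹ • x‖ + M := (norm_sub_le _ _).trans (add_le_add le_rfl (hb _ hx))
    _ = t⁻¹ * ‖x‖ + M := by rw [norm_smul, norm_inv, Real.norm_of_nonneg ht.le]

end Bounded

variable [MeasurableSpace E] [BorelSpace E]

theorem measurableSet_latticeCell [Finite ι] (b : Module.Basis ι ℝ E) (t : ℝ) (k : E) :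
    MeasurableSet (latticeCell b t k) :=
  (ZSpan.fundamentalDomain_measurableSet b).preimage
    ((continuous_const_smul t⁻¹).sub continuous_const).measurable

theorem measure_latticeCell [FiniteDimensional ℝ E] (b : Module.Basis ι ℝ E)
    (μ : Measure E) [μ.IsAddHaarMeasure] {t : ℝ} (ht : 0 < t) (k : E) :
    μ (latticeCell b t k) =
      ENNReal.ofReal (t ^ Module.finrank ℝ E) * μ (ZSpan.fundamentalDomain b) := by
  have h : latticeCell b t k =
      (fun x => t⁻¹ • x) ⁻¹' ((fun y => y + -k) ⁻¹' ZSpan.fundamentalDomain b) := by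
    simp only [latticeCell, sub_eq_add_neg]
    rfl
  rw [h, Measure.addHaar_preimage_smul μ (inv_ne_zero ht.ne'), measure_preimage_add_right, inv_pow,
    inv_inv, abs_of_pos (by positivity)]

end LatticeCell

theorem setLIntegral_compl_enorm_sq_le {E F : Type*} [SeminormedAddCommGroup E] [MeasurableSpace E]
    [NormedAddCommGroup F] {μ : Measure E} {s : Set E} {η R : NNReal} (hs : MeasurableSet s)
    (hR : Metric.closedBall 0 R ⊆ s) (hηR : η * R ^ 2 = 1) (u : E → F) :
    ∫⁻ x in sᶜ, ‖u x‖ₑ ^ 2 ∂μ ≤ η * ∫⁻ x, ‖x‖ₑ ^ 2 * ‖u x‖ₑ ^ 2 ∂μ := by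
  rw [← lintegral_const_mul' _ _ ENNReal.coe_ne_top]
  refine (setLIntegral_mono' hs.compl fun x hx => ?_).trans (setLIntegral_le_lintegral _ _)
  have hx : R ≤ ‖x‖₊ := (not_le.1 fun hle => hx (hR (mem_closedBall_zero_iff.2 hle))).le
  calc ‖u x‖ₑ ^ 2 = ((η * R ^ 2 : NNReal) : ENNReal) * ‖u x‖ₑ ^ 2 := by simp [hηR]
    _ ≤ (η * ‖x‖ₑ ^ 2) * ‖u x‖ₑ ^ 2 := by
      push_cast
      gcongr
      exact ENNReal.coe_le_coe.2 hx
    _ = η * (‖x‖ₑ ^ 2 * ‖u x‖ₑ ^ 2) := mul_assoc _ _ _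

section Rellich

variable {E : Type*} [NormedAddCommGroup E] [NormedSpace ℝ E] [MeasurableSpace E] [BorelSpace E]
  {F : Type*} [NormedAddCommGroup F] [NormedSpace ℝ F]

theorem lintegral_enorm_sub_translate_sq_le [CompleteSpace F] [SecondCountableTopology E]
    {μ : Measure E} [SFinite μ] [μ.IsAddRightInvariant] {u : E → F} (hu : ContDiff ℝ 1 u) (h : E) :
    ∫⁻ x, ‖u (x + h) - u x‖ₑ ^ 2 ∂μ ≤ ‖h‖ₑ ^ 2 * ∫⁻ x, ‖fderiv ℝ u x‖ₑ ^ 2 ∂μ := by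
  have hline : ∀ x t, HasDerivAt (fun t : ℝ => u (x + t • h)) (fderiv ℝ u (x + t • h) h) t :=
    fun x t => (hu.differentiable one_ne_zero _).hasFDerivAt.comp_hasDerivAt t
      (by simpa using ((hasDerivAt_id t).smul_const h).const_add x)
  have hcont : Continuous fun p : E × ℝ => fderiv ℝ u (p.1 + p.2 • h) h :=
    ((hu.continuous_fderiv one_ne_zero).comp (by fun_prop)).clm_apply continuous_const
  have hpointwise : ∀ x, ‖u (x + h) - u x‖ₑ ^ 2 ≤
      ∫⁻ t in Set.Ioc (0 : ℝ) 1, ‖fderiv ℝ u (x + t • h) h‖ₑ ^ 2 := fun x => by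
    have hx : Continuous fun t : ℝ => fderiv ℝ u (x + t • h) h :=
      hcont.comp (Continuous.prodMk_right x)
    have hftc := enorm_sub_le_lintegral_enorm_deriv (hline x) hx
      (Set.left_mem_Icc.2 zero_le_one) (Set.right_mem_Icc.2 zero_le_one)
    simp only [one_smul, zero_smul, add_zero] at hftc
    exact (pow_le_pow_left₀ zero_le hftc 2).trans (by
      simpa using sq_lintegral_le (μ := volume.restrict (Set.Ioc (0 : ℝ) 1))
        hx.enorm.aemeasurable)
  calc ∫⁻ x, ‖u (x + h) - u x‖ₑ ^ 2 ∂μ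
      ≤ ∫⁻ x, (∫⁻ t in Set.Ioc (0 : ℝ) 1, ‖fderiv ℝ u (x + t • h) h‖ₑ ^ 2) ∂μ :=
        lintegral_mono hpointwise
    _ = ∫⁻ _ in Set.Ioc (0 : ℝ) 1, (∫⁻ x, ‖fderiv ℝ u x h‖ₑ ^ 2 ∂μ) := by
        rw [lintegral_lintegral_swap (f := fun x t => ‖fderiv ℝ u (x + t • h) h‖ₑ ^ 2)
          (hcont.enorm.measurable.pow_const 2).aemeasurable]
        exact lintegral_congr fun t =>
          lintegral_add_right_eq_self (fun x => ‖fderiv ℝ u x h‖ₑ ^ 2) (t • h)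
    _ = ∫⁻ x, ‖fderiv ℝ u x h‖ₑ ^ 2 ∂μ := by simp
    _ ≤ ∫⁻ x, ‖h‖ₑ ^ 2 * ‖fderiv ℝ u x‖ₑ ^ 2 ∂μ := lintegral_mono fun x => by
        rw [← mul_pow, mul_comm]
        gcongr
        exact (fderiv ℝ u x).le_opENorm h
    _ = ‖h‖ₑ ^ 2 * ∫⁻ x, ‖fderiv ℝ u x‖ₑ ^ 2 ∂μ :=
        lintegral_const_mul _ ((hu.continuous_fderiv one_ne_zero).enorm.measurable.pow_const 2)

theorem enorm_sub_average_sq_le [CompleteSpace F] {X : Type*} [MeasurableSpace X] {μ : Measure X}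
    [IsFiniteMeasure μ] [NeZero μ] {f : X → F} (hf : Integrable f μ) (x : X) :
    ‖f x - ⨍ y, f y ∂μ‖ₑ ^ 2 ≤ ⨍⁻ y, ‖f y - f x‖ₑ ^ 2 ∂μ := by
  have hsub : f x - ⨍ y, f y ∂μ = ∫ y, (f x - f y) ∂((μ Set.univ)⁻¹ • μ) := by
    rw [integral_sub (integrable_const _) hf.to_average, average_eq' μ f]
    simp
  rw [hsub]
  refine (enorm_integral_sq_le (aestronglyMeasurable_const.sub
    hf.to_average.aestronglyMeasurable)).trans ?_
  simp [laverage_eq', enorm_sub_rev]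

theorem lintegral_lintegral_closedBall_enorm_sub_sq_le [CompleteSpace F] [FiniteDimensional ℝ E]
    {μ : Measure E} [μ.IsAddHaarMeasure] {u : E → F} (hu : ContDiff ℝ 1 u) (r : ℝ) :
    ∫⁻ x, (∫⁻ y in Metric.closedBall x r, ‖u y - u x‖ₑ ^ 2 ∂μ) ∂μ ≤
      ENNReal.ofReal r ^ 2 * (∫⁻ x, ‖fderiv ℝ u x‖ₑ ^ 2 ∂μ) * μ (Metric.closedBall 0 r) := by
  have hmeas : Measurable (Function.uncurry fun x h : E => ‖u (x + h) - u x‖ₑ ^ 2) :=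
    (((hu.continuous.comp continuous_add).sub
      (hu.continuous.comp continuous_fst)).enorm.measurable).pow_const 2
  have hshift : ∀ x, ∫⁻ y in Metric.closedBall x r, ‖u y - u x‖ₑ ^ 2 ∂μ =
      ∫⁻ h in Metric.closedBall 0 r, ‖u (x + h) - u x‖ₑ ^ 2 ∂μ := fun x => by
    have h := (measurePreserving_add_left μ x).setLIntegral_comp_emb
      (measurableEmbedding_addLeft x) (fun y => ‖u y - u x‖ₑ ^ 2) (Metric.closedBall 0 r)
    rw [h, Set.image_add_left, preimage_add_closedBall, sub_neg_eq_add, zero_add]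
  simp only [hshift]
  rw [lintegral_lintegral_swap (f := fun x h => ‖u (x + h) - u x‖ₑ ^ 2) hmeas.aemeasurable]
  refine (setLIntegral_mono' Metric.isClosed_closedBall.measurableSet fun h hh => ?_).trans_eq
    (setLIntegral_const _ _)
  refine (lintegral_enorm_sub_translate_sq_le hu h).trans ?_
  gcongr
  rw [← ofReal_norm]
  exact ENNReal.ofReal_le_ofReal (mem_closedBall_zero_iff.1 hh)

variable {μ : Measure E} {C : NNReal} {r : ℝ} {𝒬 : Finset (Set E)}

theorem IsMesh.sum_setLIntegral_enorm_sub_average_sq_le [CompleteSpace F] [FiniteDimensional ℝ E]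
    [μ.IsAddHaarMeasure] (h : IsMesh μ C r 𝒬) (hr : 0 < r) {u : E → F} (hu : ContDiff ℝ 1 u) :
    ∑ Q ∈ 𝒬, ∫⁻ x in Q, ‖u x - ⨍ y in Q, u y ∂μ‖ₑ ^ 2 ∂μ ≤
      C * ENNReal.ofReal r ^ 2 * ∫⁻ x, ‖fderiv ℝ u x‖ₑ ^ 2 ∂μ := by
  set v := μ (Metric.closedBall 0 r)
  have hv : v ≠ 0 := (Metric.measure_closedBall_pos μ _ hr).ne'
  have hv' : v ≠ ⊤ := measure_closedBall_lt_top.ne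
  have hcell : ∀ Q ∈ 𝒬, ∀ x ∈ Q, ‖u x - ⨍ y in Q, u y ∂μ‖ₑ ^ 2 ≤
      C * v⁻¹ * ∫⁻ y in Metric.closedBall x r, ‖u y - u x‖ₑ ^ 2 ∂μ := fun Q hQ x hx => by
    have : IsFiniteMeasure (μ.restrict Q) := ⟨by simpa using (h.measure_ne_top hQ).lt_top⟩
    have : NeZero (μ.restrict Q) := ⟨by simpa using h.measure_ne_zero hr hQ⟩
    have hint : IntegrableOn u Q μ :=
      (hu.continuous.continuousOn.integrableOn_compact (isCompact_closedBall x r)).mono_set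
        (h.subset_closedBall Q hQ x hx)
    have hinv : (μ Q)⁻¹ ≤ C * v⁻¹ := by
      rw [← div_eq_mul_inv, ENNReal.le_div_iff_mul_le (.inl hv) (.inl hv'), mul_comm,
        ← div_eq_mul_inv]
      exact ENNReal.div_le_of_le_mul (h.measure_closedBall_le Q hQ)
    refine (enorm_sub_average_sq_le hint x).trans ?_
    rw [laverage_eq, Measure.restrict_apply_univ, div_eq_mul_inv, mul_comm]
    gcongr
    exact h.subset_closedBall Q hQ x hx
  calc ∑ Q ∈ 𝒬, ∫⁻ x in Q, ‖u x - ⨍ y in Q, u y ∂μ‖ₑ ^ 2 ∂μ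
      ≤ ∑ Q ∈ 𝒬, ∫⁻ x in Q, C * v⁻¹ * (∫⁻ y in Metric.closedBall x r, ‖u y - u x‖ₑ ^ 2 ∂μ) ∂μ :=
        Finset.sum_le_sum fun Q hQ => setLIntegral_mono' (h.measurableSet Q hQ) (hcell Q hQ)
    _ = ∫⁻ x in ⋃ Q ∈ 𝒬, Q,
          C * v⁻¹ * (∫⁻ y in Metric.closedBall x r, ‖u y - u x‖ₑ ^ 2 ∂μ) ∂μ :=
        (lintegral_biUnion_finset (t := fun Q => Q) h.pairwiseDisjoint h.measurableSet _).symm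
    _ ≤ ∫⁻ x, C * v⁻¹ * (∫⁻ y in Metric.closedBall x r, ‖u y - u x‖ₑ ^ 2 ∂μ) ∂μ :=
        setLIntegral_le_lintegral _ _
    _ ≤ C * v⁻¹ * (ENNReal.ofReal r ^ 2 * (∫⁻ x, ‖fderiv ℝ u x‖ₑ ^ 2 ∂μ) * v) := by
        rw [lintegral_const_mul' _ _ (ENNReal.mul_ne_top ENNReal.coe_ne_top
          (ENNReal.inv_ne_top.2 hv))]
        gcongr
        exact lintegral_lintegral_closedBall_enorm_sub_sq_le hu r
    _ = C * ENNReal.ofReal r ^ 2 * ∫⁻ x, ‖fderiv ℝ u x‖ₑ ^ 2 ∂μ := by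
        rw [mul_comm (ENNReal.ofReal r ^ 2 * _) v, mul_assoc (C : ENNReal), ← mul_assoc v⁻¹,
          ENNReal.inv_mul_cancel hv hv', one_mul, mul_assoc]

theorem exists_isMesh [FiniteDimensional ℝ E] (μ : Measure E) [μ.IsAddHaarMeasure] :
    ∃ C : NNReal, ∀ r > 0, ∀ R, ∃ 𝒬 : Finset (Set E),
      IsMesh μ C r 𝒬 ∧ Metric.closedBall 0 R ⊆ ⋃ Q ∈ 𝒬, Q := by
  classical
  let b := Module.finBasis ℝ E
  obtain ⟨M, hM, hb⟩ := (ZSpan.fundamentalDomain_isBounded b).exists_pos_norm_le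
  set v := μ (ZSpan.fundamentalDomain b)
  have hv : v ≠ 0 := ZSpan.measure_fundamentalDomain_ne_zero b
  have hv' : v ≠ ⊤ := (ZSpan.fundamentalDomain_isBounded b).measure_lt_top.ne
  refine ⟨(μ (Metric.closedBall 0 (2 * M)) / v).toNNReal, fun r hr R => ?_⟩
  obtain ⟨t, ht, rfl⟩ : ∃ t > 0, r = t * (2 * M) := ⟨r / (2 * M), by positivity, by field_simp⟩
  have hfin : (Metric.closedBall (0 : E) (t⁻¹ * R + M) ∩ Submodule.span ℤ (Set.range b)).Finite :=
    ZSpan.setFinite_inter b Metric.isBounded_closedBall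
  refine ⟨hfin.toFinset.image (latticeCell b t), ⟨?_, ?_, ?_, ?_⟩, fun x hx => ?_⟩
  · exact Finset.forall_mem_image.2 fun k _ => measurableSet_latticeCell b t k
  · simp only [Set.Pairwise, Finset.coe_image, Set.forall_mem_image,
      Set.Finite.coe_toFinset]
    refine fun k hk l hl hkl => Set.disjoint_left.2 fun x hxk hxl => hkl ?_
    rw [(existsUnique_mem_latticeCell b t x).unique ⟨hk.2, hxk⟩ ⟨hl.2, hxl⟩]
  · simp only [Finset.forall_mem_image]
    exact fun k _ x hx => latticeCell_subset_closedBall hb ht hx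
  · simp only [Finset.forall_mem_image]
    intro k _
    rw [measure_latticeCell b μ ht, Measure.addHaar_closedBall_mul μ 0 ht.le (by positivity),
      ENNReal.coe_toNNReal (ENNReal.div_ne_top measure_closedBall_lt_top.ne hv), mul_left_comm,
      ENNReal.div_mul_cancel hv hv']
  · obtain ⟨k, ⟨hk, hxk⟩, -⟩ := existsUnique_mem_latticeCell b t x
    have hnorm : ‖k‖ ≤ t⁻¹ * R + M := (norm_le_of_mem_latticeCell hb ht hxk).trans <| by
      gcongr
      exact mem_closedBall_zero_iff.1 hx
    exact Set.mem_biUnion (Finset.mem_image_of_mem _ (by simpa using ⟨hnorm, hk⟩)) hxk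

/- The trap controls the mass outside a large ball; inside, the function is replaced by its averages
over the cells of a fine mesh. -/
theorem exists_finiteDimensional_enorm_sub_sq_le (𝕜 : Type*) [RCLike 𝕜] [FiniteDimensional ℝ E]
    (μ : Measure E) [μ.IsAddHaarMeasure] {η : NNReal} (hη : η ≠ 0) :
    ∃ V : Submodule 𝕜 (Lp 𝕜 2 μ), FiniteDimensional 𝕜 V ∧
      ∀ u : E → 𝕜, ContDiff ℝ 1 u → ∀ hu : MemLp u 2 μ, ∃ w ∈ V,
        ‖hu.toLp u - w‖ₑ ^ 2 ≤
          η * ((∫⁻ x, ‖fderiv ℝ u x‖ₑ ^ 2 ∂μ) + ∫⁻ x, ‖x‖ₑ ^ 2 * ‖u x‖ₑ ^ 2 ∂μ) := by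
  obtain ⟨C, hC⟩ := exists_isMesh μ
  obtain ⟨r, hr, hCr⟩ : ∃ r : NNReal, 0 < r ∧ C * r ^ 2 ≤ η := by
    refine ⟨NNReal.sqrt (η / (C + 1)), by positivity, ?_⟩
    rw [NNReal.sq_sqrt, mul_div_assoc']
    exact div_le_of_le_mul₀ (by positivity) (by positivity) (by rw [mul_comm]; gcongr; simp)
  obtain ⟨R, hηR⟩ : ∃ R : NNReal, η * R ^ 2 = 1 :=
    ⟨NNReal.sqrt η⁻¹, by rw [NNReal.sq_sqrt, mul_inv_cancel₀ hη]⟩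
  obtain ⟨𝒬, hmesh, hcover⟩ := hC r hr R
  obtain ⟨V, hV, hstep⟩ := hmesh.exists_finiteDimensional_stepFunctions 𝕜
  refine ⟨V, hV, fun u hu1 hu => ?_⟩
  obtain ⟨w, hwV, hw⟩ := hstep fun Q => ⨍ y in Q, u y ∂μ
  refine ⟨w, hwV, ?_⟩
  calc ‖hu.toLp u - w‖ₑ ^ 2
      = ∫⁻ x, ‖u x - ∑ Q ∈ 𝒬, Q.indicator (fun _ => ⨍ y in Q, u y ∂μ) x‖ₑ ^ 2 ∂μ := by
        rw [Lp.enorm_def, eLpNorm_two_sq]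
        refine lintegral_congr_ae ?_
        filter_upwards [Lp.coeFn_sub (hu.toLp u) w, hu.coeFn_toLp, hw] with x h1 h2 h3
        rw [h1, Pi.sub_apply, h2, h3]
    _ ≤ (C * r ^ 2 : NNReal) * (∫⁻ x, ‖fderiv ℝ u x‖ₑ ^ 2 ∂μ) +
          η * ∫⁻ x, ‖x‖ₑ ^ 2 * ‖u x‖ₑ ^ 2 ∂μ := by
        rw [hmesh.lintegral_enorm_sub_sum_indicator_sq]
        refine add_le_add ?_ (setLIntegral_compl_enorm_sq_le
          (𝒬.measurableSet_biUnion hmesh.measurableSet) hcover hηR u)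
        simpa using hmesh.sum_setLIntegral_enorm_sub_average_sq_le hr hu1
    _ ≤ _ := by
        rw [mul_add]
        gcongr

end Rellich

section Hilbert

variable {𝕜 : Type*} [RCLike 𝕜]
  {H : Type*} [NormedAddCommGroup H] [InnerProductSpace 𝕜 H] [CompleteSpace H]

theorem isCompactOperator_of_forall_infDist_le {E : Type*} [NormedAddCommGroup E] [NormedSpace 𝕜 E]
    (T : E →L[𝕜] H)
    (hT : ∀ η > 0, ∃ V : Submodule 𝕜 H, FiniteDimensional 𝕜 V ∧
      ∀ x, Metric.infDist (T x) V ≤ η * ‖x‖) :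
    IsCompactOperator T := by
  refine isClosed_setOfPred_isCompactOperator.closure_subset <|
    Metric.mem_closure_iff.2 fun η hη => ?_
  obtain ⟨V, hV, hTV⟩ := hT (η / 2) (half_pos hη)
  refine ⟨V.starProjection ∘L T, ?_, (?_ : _ ≤ η / 2).trans_lt (half_lt_self hη)⟩
  · have : ProperSpace V := FiniteDimensional.proper_rclike 𝕜 V
    have hV : IsCompactOperator (V.orthogonalProjectionOnto : H →L[𝕜] V) :=
      isCompactOperator_of_locallyCompactSpace_dom _
    exact IsCompactOperator.clm_comp (hV.comp_clm T) V.subtypeL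
  · rw [dist_eq_norm]
    refine ContinuousLinearMap.opNorm_le_bound _ (half_pos hη).le fun x => ?_
    refine le_of_eq_of_le ?_ (hTV x)
    simp [Metric.infDist_eq_iInf, V.starProjection_minimal, dist_eq_norm]

variable {K : Type*} [NormedAddCommGroup K] [InnerProductSpace 𝕜 K] [CompleteSpace K]

theorem isCompactOperator_comp_starProjection (D : Submodule 𝕜 K) (π : K →L[𝕜] H)
    (h : ∀ η > 0, ∃ V : Submodule 𝕜 H, FiniteDimensional 𝕜 V ∧
      ∀ w ∈ D, Metric.infDist (π w) V ≤ η * ‖w‖) :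
    IsCompactOperator (π ∘L D.topologicalClosure.starProjection) := by
  refine isCompactOperator_of_forall_infDist_le _ fun η hη => ?_
  obtain ⟨V, hV, hD⟩ := h η hη
  have hclosed : IsClosed {w | Metric.infDist (π w) V ≤ η * ‖w‖} :=
    isClosed_le ((Metric.continuous_infDist_pt _).comp π.continuous)
      (continuous_const.mul continuous_norm)
  refine ⟨V, hV, fun x => ?_⟩
  have hmem : D.topologicalClosure.starProjection x ∈ D.topologicalClosure :=
    Submodule.starProjection_apply_mem _ x
  calc Metric.infDist (π (D.topologicalClosure.starProjection x)) V
      ≤ η * ‖D.topologicalClosure.starProjection x‖ :=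
        closure_minimal (s := (D : Set K)) hD hclosed hmem
    _ ≤ η * ‖x‖ := by
        gcongr
        exact Submodule.norm_starProjection_apply_le _ x

open ContinuousLinearMap in
theorem eq_starProjection_adjoint_iff (D : Submodule 𝕜 K) (π : K →L[𝕜] H) (f : H) (p : K) :
    p = D.topologicalClosure.starProjection (adjoint π f) ↔
      p ∈ D.topologicalClosure ∧ ∀ w ∈ D, inner 𝕜 p w = inner 𝕜 f (π w) := by
  have hclosed : IsClosed {w | inner 𝕜 (adjoint π f - p) w = 0} :=
    isClosed_eq (by fun_prop) continuous_const
  have hiff (w : K) : inner 𝕜 (adjoint π f - p) w = 0 ↔ inner 𝕜 p w = inner 𝕜 f (π w) := by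
    rw [inner_sub_left, adjoint_inner_left, sub_eq_zero, eq_comm]
  constructor
  · rintro rfl
    refine ⟨Submodule.starProjection_apply_mem _ _, fun w hw => (hiff w).1 ?_⟩
    exact Submodule.starProjection_inner_eq_zero _ _ (D.le_topologicalClosure hw)
  · rintro ⟨hp, h⟩
    exact (Submodule.eq_starProjection_of_mem_of_inner_eq_zero hp <|
      closure_minimal (fun w hw => (hiff w).2 (h w hw)) hclosed).symm

end Hilbert

theorem measurePreserving_of_preimage_eq {E : Type*} [NormedAddCommGroup E] [NormedSpace ℝ E]
    [FiniteDimensional ℝ E] [MeasurableSpace E] [BorelSpace E] (μ : Measure E) [μ.IsAddHaarMeasure]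
    (f : E →ₗ[ℝ] E) {s : Set E} (hs : s ∈ 𝓝 0) (hbdd : Bornology.IsBounded s) (hfs : f ⁻¹' s = s) :
    MeasurePreserving f μ μ := by
  have hs0 : μ s ≠ 0 := (Measure.measure_pos_of_mem_nhds μ hs).ne'
  have hs1 : μ s ≠ ⊤ := hbdd.measure_lt_top.ne
  have hker : LinearMap.ker f = ⊥ := by
    refine (Submodule.eq_bot_iff _).2 fun x hx => ?_
    obtain ⟨M, hM⟩ := hbdd.exists_norm_le
    have hline : ∀ t : ℝ, ‖t • x‖ ≤ M := fun t => hM _ <| by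
      rw [← hfs, Set.mem_preimage, map_smul, LinearMap.mem_ker.1 hx, smul_zero]
      exact mem_of_mem_nhds hs
    by_contra hx0
    have := hline ((|M| + 1) / ‖x‖)
    rw [norm_smul, norm_div, norm_norm, div_mul_cancel₀ _ (norm_ne_zero_iff.2 hx0),
      Real.norm_of_nonneg (by positivity)] at this
    linarith [le_abs_self M]
  have hdet : LinearMap.det f ≠ 0 := fun h => (LinearMap.bot_lt_ker_of_det_eq_zero h).ne' hker
  have hscale := Measure.addHaar_preimage_linearMap μ hdet s
  rw [hfs] at hscale
  have hone : ENNReal.ofReal |(LinearMap.det f)⁻¹| = 1 :=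
    ((ENNReal.mul_left_inj hs0 hs1).1 ((one_mul _).trans hscale)).symm
  exact ⟨f.continuous_of_finiteDimensional.measurable, by
    rw [Measure.map_linearMap_addHaar_eq_smul_addHaar _ hdet, hone, one_smul]⟩

theorem isClosed_setOf_ae_eq_mul {X 𝕜 : Type*} [MeasurableSpace X] [RCLike 𝕜] {μ : Measure X}
    {p : ENNReal} [Fact (1 ≤ p)] (w : X → 𝕜) :
    IsClosed {q : Lp 𝕜 p μ × Lp 𝕜 p μ | q.2 =ᵐ[μ] fun x => w x * q.1 x} := by
  refine IsSeqClosed.isClosed fun q l hq hl => ?_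
  obtain ⟨ns, hns, h₁⟩ := (tendstoInMeasure_of_tendsto_Lp
    ((continuous_fst.tendsto l).comp hl)).exists_seq_tendsto_ae
  obtain ⟨ms, hms, h₂⟩ := (tendstoInMeasure_of_tendsto_Lp
    (((continuous_snd.tendsto l).comp hl).comp hns.tendsto_atTop)).exists_seq_tendsto_ae
  filter_upwards [h₁, h₂, ae_all_iff.2 hq] with x hx₁ hx₂ hqx
  refine tendsto_nhds_unique hx₂ <| ((hx₁.comp hms.tendsto_atTop).const_mul (w x)).congr fun n => ?_
  exact (hqx (ns (ms n))).symm

namespace Anyon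

variable {N : ℕ}

/-- Smooth functions with compact support off the diagonals, that is, the core without the
permutation invariance: unlike the core, this class is preserved by each `magneticDeriv α j a`. -/
structure IsTest (φ : Config N → ℂ) : Prop where
  smooth : ContDiff ℝ ∞ φ
  compact : HasCompactSupport φ
  support : tsupport φ ⊆ (diagonal N)ᶜ

theorem IsCore.isTest {φ : Config N → ℂ} (h : IsCore φ) : IsTest φ :=
  ⟨h.smooth, h.compact, h.support⟩

namespace IsTest

variable {φ ψ : Config N → ℂ}

theorem of_tsupport_subset (h : IsTest φ) (hψ : ContDiff ℝ ∞ ψ) (hs : tsupport ψ ⊆ tsupport φ) :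
    IsTest ψ :=
  ⟨hψ, h.compact.isCompact.of_isClosed_subset (isClosed_tsupport _) hs, hs.trans h.support⟩

theorem continuous (h : IsTest φ) : Continuous φ := h.smooth.continuous

theorem differentiable (h : IsTest φ) : Differentiable ℝ φ := h.smooth.differentiable (by simp)

theorem memLp (h : IsTest φ) : MemLp φ 2 volume :=
  h.continuous.memLp_of_hasCompactSupport h.compact

theorem apply_eq_zero (h : IsTest φ) {x : Config N} (hx : x ∈ diagonal N) : φ x = 0 :=
  image_eq_zero_of_notMem_tsupport fun hx' => h.support hx' hx

theorem add (hφ : IsTest φ) (hψ : IsTest ψ) : IsTest (φ + ψ) :=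
  ⟨hφ.smooth.add hψ.smooth, hφ.compact.add hψ.compact,
    (tsupport_add φ ψ).trans (Set.union_subset hφ.support hψ.support)⟩

theorem mul_left (h : IsTest φ) {g : Config N → ℂ} (hg : ∀ x ∉ diagonal N, ContDiffAt ℝ ∞ g x) :
    IsTest (fun x => g x * φ x) := by
  refine h.of_tsupport_subset (contDiff_iff_contDiffAt.2 fun x => ?_) tsupport_mul_subset_right
  by_cases hx : x ∈ tsupport φ
  · exact (hg x (h.support hx)).mul h.smooth.contDiffAt
  · refine contDiffAt_const (c := 0) |>.congr_of_eventuallyEq ?_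
    filter_upwards [notMem_tsupport_iff_eventuallyEq.1 hx] with y hy
    simp [hy]

theorem ofReal_mul (h : IsTest φ) {g : Config N → ℝ}
    (hg : ∀ x ∉ diagonal N, ContDiffAt ℝ ∞ g x) : IsTest (fun x => (g x : ℂ) * φ x) :=
  h.mul_left fun x hx => Complex.ofRealCLM.contDiff.contDiffAt.comp x (hg x hx)

theorem const_smul (h : IsTest φ) (c : ℂ) : IsTest (c • φ) :=
  h.mul_left fun _ _ => contDiffAt_const

protected theorem partialDeriv (h : IsTest φ) (j : Fin N) (a : Fin 2) :
    IsTest (partialDeriv j a φ) :=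
  h.of_tsupport_subset ((h.smooth.fderiv_right (m := ∞) (by simp)).clm_apply contDiff_const)
    (tsupport_fderiv_apply_subset ℝ _)

theorem integrable_mul (h : IsTest φ) {g : Config N → ℂ} (hg : Continuous g) :
    Integrable (fun x => g x * φ x) :=
  (hg.mul h.continuous).integrable_of_hasCompactSupport h.compact.mul_left

theorem integrable_conj_mul (hφ : IsTest φ) (hψ : IsTest ψ) :
    Integrable (fun x => conj (φ x) * ψ x) :=
  hψ.integrable_mul (Complex.continuous_conj.comp hφ.continuous)

theorem integrable_mul_norm_sq (h : IsTest φ) {g : Config N → ℝ}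
    (hg : ∀ x ∉ diagonal N, ContDiffAt ℝ ∞ g x) : Integrable (fun x => g x * ‖φ x‖ ^ 2) := by
  refine (h.integrable_conj_mul (h.ofReal_mul hg)).re.congr (.of_forall fun x => ?_)
  simp only [mul_left_comm _ (g x : ℂ), Complex.conj_mul', RCLike.re_eq_complex_re,
    Complex.re_ofReal_mul]
  norm_cast

theorem integrable_norm_sq (h : IsTest φ) : Integrable (fun x => ‖φ x‖ ^ 2) :=
  h.memLp.integrable_norm_pow (by simp)

theorem lintegral_enorm_sq (h : IsTest φ) :
    ∫⁻ x, ‖φ x‖ₑ ^ 2 = ENNReal.ofReal (∫ x, ‖φ x‖ ^ 2) := by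
  rw [ofReal_integral_eq_lintegral_ofReal h.integrable_norm_sq (.of_forall fun x => by positivity)]
  simp only [ENNReal.ofReal_pow (norm_nonneg _), ofReal_norm]

end IsTest

theorem contDiff_coord (j : Fin N) (a : Fin 2) : ContDiff ℝ ∞ (fun x : Config N => x j a) :=
  (EuclideanSpace.proj a : Plane →L[ℝ] ℝ).contDiff.comp (contDiff_apply ℝ Plane j)

theorem contDiffAt_vectorPotential (j : Fin N) (a : Fin 2) {x : Config N} (hx : x ∉ diagonal N) :
    ContDiffAt ℝ ∞ (fun x => vectorPotential j x a) x := by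
  have hperp (k : Fin N) : ContDiff ℝ ∞ (fun x : Config N => perp (x j - x k) a) := by
    fin_cases a
    · exact ((contDiff_coord j 1).sub (contDiff_coord k 1)).neg
    · exact (contDiff_coord j 0).sub (contDiff_coord k 0)
  simp only [vectorPotential, WithLp.ofLp_sum, Finset.sum_apply, PiLp.smul_apply, smul_eq_mul]
  refine ContDiffAt.sum fun k hk => .mul (.inv ?_ ?_) (hperp k).contDiffAt
  · exact (((contDiff_apply ℝ Plane j).sub (contDiff_apply ℝ Plane k)).norm_sq ℝ).contDiffAt
  · have hne : x j ≠ x k := fun h => hx ⟨j, k, (Finset.ne_of_mem_erase hk).symm, h⟩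
    exact pow_ne_zero 2 (norm_ne_zero_iff.2 (sub_ne_zero.2 hne))

protected theorem IsTest.magneticDeriv {φ : Config N → ℂ} (h : IsTest φ) (α : ℝ) (j : Fin N)
    (a : Fin 2) : IsTest (magneticDeriv α j a φ) :=
  ((h.partialDeriv j a).const_smul (-Complex.I)).add <|
    h.ofReal_mul fun _ hx => contDiffAt_const.mul (contDiffAt_vectorPotential j a hx)

theorem partialDeriv_add {φ ψ : Config N → ℂ} (hφ : IsTest φ) (hψ : IsTest ψ) (j : Fin N)
    (a : Fin 2) : partialDeriv j a (φ + ψ) = partialDeriv j a φ + partialDeriv j a ψ := by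
  funext x
  simp only [partialDeriv, fderiv_add (hφ.differentiable x) (hψ.differentiable x), add_apply,
    Pi.add_apply]

theorem partialDeriv_const_smul {φ : Config N → ℂ} (hφ : IsTest φ) (c : ℂ) (j : Fin N)
    (a : Fin 2) : partialDeriv j a (c • φ) = c • partialDeriv j a φ := by
  funext x
  simp only [partialDeriv, fderiv_const_smul (hφ.differentiable x), smul_apply, Pi.smul_apply]

theorem magneticDeriv_add {φ ψ : Config N → ℂ} (hφ : IsTest φ) (hψ : IsTest ψ) (α : ℝ)
    (j : Fin N) (a : Fin 2) :
    magneticDeriv α j a (φ + ψ) = magneticDeriv α j a φ + magneticDeriv α j a ψ := by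
  funext x
  simp only [magneticDeriv, partialDeriv_add hφ hψ, Pi.add_apply]
  ring

theorem magneticDeriv_const_smul {φ : Config N → ℂ} (hφ : IsTest φ) (c : ℂ) (α : ℝ) (j : Fin N)
    (a : Fin 2) : magneticDeriv α j a (c • φ) = c • magneticDeriv α j a φ := by
  funext x
  simp only [magneticDeriv, partialDeriv_const_smul hφ, Pi.smul_apply, smul_eq_mul]
  ring

theorem IsTest.integral_mul_partialDeriv {φ ψ : Config N → ℂ} (hφ : IsTest φ)
    (hψ : ContDiff ℝ ∞ ψ) (j : Fin N) (a : Fin 2) :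
    ∫ x, φ x * Anyon.partialDeriv j a ψ x = -∫ x, Anyon.partialDeriv j a φ x * ψ x := by
  have hψ' : Continuous (Anyon.partialDeriv j a ψ) :=
    ((hψ.fderiv_right (m := ∞) (by simp)).clm_apply contDiff_const).continuous
  refine integral_mul_fderiv_eq_neg_fderiv_mul_of_integrable ?_ ?_ ?_
    (fun x _ => hφ.differentiable x) (fun x _ => hψ.differentiable (by simp) x)
  · simpa only [mul_comm, Anyon.partialDeriv] using
      (hφ.partialDeriv j a).integrable_mul hψ.continuous
  · simpa only [mul_comm, Anyon.partialDeriv] using hφ.integrable_mul hψ'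
  · simpa only [mul_comm] using hφ.integrable_mul hψ.continuous

theorem IsTest.integral_conj_magneticDeriv {φ ψ : Config N → ℂ} (hφ : IsTest φ) (hψ : IsTest ψ)
    (α : ℝ) (j : Fin N) (a : Fin 2) :
    ∫ x, conj (Anyon.magneticDeriv α j a φ x) * ψ x =
      ∫ x, conj (φ x) * Anyon.magneticDeriv α j a ψ x := by
  have hconj (x) : Anyon.partialDeriv j a (fun y => conj (φ y)) x =
      conj (Anyon.partialDeriv j a φ x) := by
    have h : HasFDerivAt (fun y => conj (φ y)) _ x :=
      Complex.conjCLE.toContinuousLinearMap.hasFDerivAt.comp x (hφ.differentiable x).hasFDerivAt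
    simp [Anyon.partialDeriv, h.fderiv]
  have hparts : ∫ x, conj (Anyon.partialDeriv j a φ x) * ψ x =
      -∫ x, conj (φ x) * Anyon.partialDeriv j a ψ x := by
    have h := hψ.integral_mul_partialDeriv (ψ := fun y => conj (φ y))
      (Complex.conjCLE.toContinuousLinearMap.contDiff.comp hφ.smooth) j a
    simpa only [hconj, mul_comm] using h
  have hA := hφ.integrable_conj_mul <| hψ.ofReal_mul (g := fun x => α * vectorPotential j x a)
    fun _ hx => contDiffAt_const.mul (contDiffAt_vectorPotential j a hx)
  calc ∫ x, conj (Anyon.magneticDeriv α j a φ x) * ψ x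
      = ∫ x, (Complex.I * (conj (Anyon.partialDeriv j a φ x) * ψ x) +
          conj (φ x) * (((α * vectorPotential j x a : ℝ) : ℂ) * ψ x)) := by
        refine integral_congr_ae (.of_forall fun x => ?_)
        simp only [Anyon.magneticDeriv, map_add, map_mul, map_neg, Complex.conj_I,
          Complex.conj_ofReal]
        ring
    _ = -Complex.I * (∫ x, conj (φ x) * Anyon.partialDeriv j a ψ x) +
          ∫ x, conj (φ x) * (((α * vectorPotential j x a : ℝ) : ℂ) * ψ x) := by
        rw [integral_add (((hφ.partialDeriv j a).integrable_conj_mul hψ).const_mul _) hA,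
          integral_const_mul, hparts]
        ring
    _ = ∫ x, conj (φ x) * Anyon.magneticDeriv α j a ψ x := by
        rw [← integral_const_mul,
          ← integral_add ((hφ.integrable_conj_mul (hψ.partialDeriv j a)).const_mul _) hA]
        refine integral_congr_ae (.of_forall fun x => ?_)
        simp only [Anyon.magneticDeriv]
        ring

/-- The pointwise kinetic energy `∑_j |D_j φ|²`. -/
def kineticDensity (α : ℝ) (φ : Config N → ℂ) (x : Config N) : ENNReal :=
  ∑ j, ∑ a, ‖magneticDeriv α j a φ x‖ₑ ^ 2

/-- The kinetic energy `∑_j ∫ |D_j φ|²`, that is, the form `energy` without the trap. -/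
def kinetic (α : ℝ) (φ : Config N → ℂ) : ENNReal :=
  ∫⁻ x, kineticDensity α φ x

theorem IsTest.kinetic_eq {φ : Config N → ℂ} (hφ : IsTest φ) (α : ℝ) :
    kinetic α φ = ENNReal.ofReal (∑ j, ∑ a, ∫ x, ‖Anyon.magneticDeriv α j a φ x‖ ^ 2) := by
  have hD (j : Fin N) (a : Fin 2) := hφ.magneticDeriv α j a
  have hmeas (j : Fin N) (a : Fin 2) := ((hD j a).continuous.measurable.enorm.pow_const 2)
  simp only [kinetic, kineticDensity]
  rw [lintegral_finsetSum _ fun j _ => Finset.measurable_sum _ fun a _ => hmeas j a,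
    ENNReal.ofReal_sum_of_nonneg fun j _ => by positivity]
  refine Finset.sum_congr rfl fun j _ => ?_
  rw [lintegral_finsetSum _ fun a _ => hmeas j a,
    ENNReal.ofReal_sum_of_nonneg fun a _ => by positivity]
  exact Finset.sum_congr rfl fun a _ => (hD j a).lintegral_enorm_sq

theorem IsTest.magneticDeriv_ofReal_mul {φ : Config N → ℂ} (hφ : IsTest φ) {g : Config N → ℝ}
    (hg : ∀ x ∉ diagonal N, ContDiffAt ℝ ∞ g x) (α : ℝ) (j : Fin N) (a : Fin 2) (x : Config N) :
    Anyon.magneticDeriv α j a (fun y => (g y : ℂ) * φ y) x =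
      g x * Anyon.magneticDeriv α j a φ x - Complex.I * fderiv ℝ g x (unitVec j a) * φ x := by
  by_cases hx : x ∈ tsupport φ
  · have hg' := Complex.ofRealCLM.hasFDerivAt.comp x
      ((hg x (hφ.support hx)).differentiableAt (by simp)).hasFDerivAt
    have h : fderiv ℝ (fun y => (g y : ℂ) * φ y) x = _ :=
      (hg'.mul (hφ.differentiable x).hasFDerivAt).fderiv
    simp only [Anyon.magneticDeriv, Anyon.partialDeriv, h, add_apply, smul_apply, smul_eq_mul,
      ContinuousLinearMap.comp_apply, Function.comp_apply, Complex.ofRealCLM_apply]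
    ring
  · have h := fderiv_of_notMem_tsupport ℝ hx
    have hgφ := fderiv_of_notMem_tsupport ℝ fun hx' =>
      hx (tsupport_mul_subset_right (f := fun y => (g y : ℂ)) hx')
    simp [Anyon.magneticDeriv, Anyon.partialDeriv, h, hgφ, image_eq_zero_of_notMem_tsupport hx]

theorem IsTest.two_mul_im_integral_conj_magneticDeriv_mul {φ : Config N → ℂ} (hφ : IsTest φ)
    {g : Config N → ℝ} (hg : ∀ x ∉ diagonal N, ContDiffAt ℝ ∞ g x) (α : ℝ) (j : Fin N)
    (a : Fin 2) : 2 * (∫ x, conj (Anyon.magneticDeriv α j a φ x) * (g x * φ x)).im =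
      -∫ x, fderiv ℝ g x (unitVec j a) * ‖φ x‖ ^ 2 := by
  have hgφ := hφ.ofReal_mul hg
  have hg' : ∀ x ∉ diagonal N, ContDiffAt ℝ ∞ (fun y => fderiv ℝ g y (unitVec j a)) x :=
    fun x hx => ((hg x hx).fderiv_right (m := ∞) (by simp)).clm_apply contDiffAt_const
  have hint : Integrable fun x => conj (conj (Anyon.magneticDeriv α j a φ x) * (g x * φ x)) :=
    Complex.conjCLE.toContinuousLinearMap.integrable_comp
      ((hφ.magneticDeriv α j a).integrable_conj_mul hgφ)
  have hint' : Integrable fun x =>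
      Complex.I * ((fderiv ℝ g x (unitVec j a) * ‖φ x‖ ^ 2 : ℝ) : ℂ) :=
    (hφ.integrable_mul_norm_sq hg').ofReal.const_mul _
  have hsymm : ∫ x, conj (Anyon.magneticDeriv α j a φ x) * (g x * φ x) =
      conj (∫ x, conj (Anyon.magneticDeriv α j a φ x) * (g x * φ x)) -
        Complex.I * ((∫ x, fderiv ℝ g x (unitVec j a) * ‖φ x‖ ^ 2 : ℝ) : ℂ) := by
    rw [← integral_complex_ofReal, ← integral_const_mul, ← integral_conj,
      ← integral_sub hint hint', hφ.integral_conj_magneticDeriv hgφ α j a]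
    refine integral_congr_ae (.of_forall fun x => ?_)
    simp only [hφ.magneticDeriv_ofReal_mul hg, map_mul, Complex.conj_conj, Complex.conj_ofReal,
      Complex.ofReal_mul, Complex.ofReal_pow, ← Complex.conj_mul']
    ring
  have him := congrArg Complex.im hsymm
  simp only [Complex.sub_im, Complex.conj_im, Complex.im_mul_ofReal, Complex.I_im] at him
  linarith

theorem IsTest.integral_fderiv_sub_sq_mul_norm_sq_le {φ : Config N → ℂ} (hφ : IsTest φ)
    {g : Config N → ℝ} (hg : ∀ x ∉ diagonal N, ContDiffAt ℝ ∞ g x) (α : ℝ) (j : Fin N)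
    (a : Fin 2) : ∫ x, (fderiv ℝ g x (unitVec j a) - g x ^ 2) * ‖φ x‖ ^ 2 ≤
      ∫ x, ‖Anyon.magneticDeriv α j a φ x‖ ^ 2 := by
  have hD := hφ.magneticDeriv α j a
  have hg' : ∀ x ∉ diagonal N, ContDiffAt ℝ ∞ (fun y => fderiv ℝ g y (unitVec j a)) x :=
    fun x hx => ((hg x hx).fderiv_right (m := ∞) (by simp)).clm_apply contDiffAt_const
  have hsq := hφ.integrable_mul_norm_sq (g := fun x => g x ^ 2) fun x hx => (hg x hx).pow 2
  have hcross := hD.integrable_conj_mul (hφ.ofReal_mul hg)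
  have hsum : Integrable fun x => ‖Anyon.magneticDeriv α j a φ x‖ ^ 2 +
      2 * (conj (Anyon.magneticDeriv α j a φ x) * (g x * φ x)).im :=
    hD.integrable_norm_sq.add (hcross.im.const_mul 2)
  have hexpand (x : Config N) : ‖Anyon.magneticDeriv α j a φ x - Complex.I * (g x * φ x)‖ ^ 2 =
      ‖Anyon.magneticDeriv α j a φ x‖ ^ 2 +
        2 * (conj (Anyon.magneticDeriv α j a φ x) * (g x * φ x)).im + g x ^ 2 * ‖φ x‖ ^ 2 := by
    simp only [Complex.sq_norm, Complex.normSq_apply, Complex.sub_re, Complex.sub_im,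
      Complex.mul_re, Complex.mul_im, Complex.I_re, Complex.I_im, Complex.conj_re,
      Complex.conj_im, Complex.ofReal_re, Complex.ofReal_im]
    ring
  have hnonneg : 0 ≤ ∫ x, ‖Anyon.magneticDeriv α j a φ x - Complex.I * (g x * φ x)‖ ^ 2 :=
    integral_nonneg fun x => by positivity
  have him := hφ.two_mul_im_integral_conj_magneticDeriv_mul hg α j a
  rw [← RCLike.im_eq_complex_im, ← integral_im hcross, ← integral_const_mul] at him
  simp only [hexpand, ← RCLike.im_eq_complex_im] at hnonneg hsum
  rw [integral_add hsum hsq, integral_add hD.integrable_norm_sq (hcross.im.const_mul 2), him]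
    at hnonneg
  simp only [sub_mul]
  rw [integral_sub (hφ.integrable_mul_norm_sq hg') hsq]
  linarith

/-- The bilinear form polarizing `tripleSq j k l`. -/
def tripleForm (j k l : Fin N) (x y : Config N) : ℝ :=
  inner ℝ (x j - x k) (y j - y k) + inner ℝ (x k - x l) (y k - y l) +
    inner ℝ (x l - x j) (y l - y j)

/-- The square `ρ²` of the distance of the configuration to the triple collision
`x_j = x_k = x_l`, normalized as the sum of the squared sides of the triangle. -/
def tripleSq (j k l : Fin N) (x : Config N) : ℝ :=
  ‖x j - x k‖ ^ 2 + ‖x k - x l‖ ^ 2 + ‖x l - x j‖ ^ 2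

theorem contDiff_tripleForm (j k l : Fin N) (y : Config N) :
    ContDiff ℝ ∞ (fun x => tripleForm j k l x y) := by
  have h (j k : Fin N) : ContDiff ℝ ∞ (fun x : Config N => inner ℝ (x j - x k) (y j - y k)) :=
    ((contDiff_apply ℝ Plane j).sub (contDiff_apply ℝ Plane k)).inner ℝ contDiff_const
  exact ((h j k).add (h k l)).add (h l j)

theorem contDiff_tripleSq (j k l : Fin N) : ContDiff ℝ ∞ (tripleSq j k l) := by
  have h (j k : Fin N) : ContDiff ℝ ∞ (fun x : Config N => ‖x j - x k‖ ^ 2) :=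
    ((contDiff_apply ℝ Plane j).sub (contDiff_apply ℝ Plane k)).norm_sq ℝ
  exact ((h j k).add (h k l)).add (h l j)

theorem tripleSq_pos {j k : Fin N} (hjk : j ≠ k) (l : Fin N) {x : Config N}
    (hx : x ∉ diagonal N) : 0 < tripleSq j k l x := by
  have : 0 < ‖x j - x k‖ := norm_pos_iff.2 (sub_ne_zero.2 fun h => hx ⟨j, k, hjk, h⟩)
  unfold tripleSq
  positivity

theorem tripleForm_add_smul (j k l : Fin N) (x y : Config N) (t : ℝ) :
    tripleForm j k l (x + t • y) y = tripleForm j k l x y + t * tripleSq j k l y := by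
  have h (j k : Fin N) : (x + t • y) j - (x + t • y) k = (x j - x k) + t • (y j - y k) := by
    simp only [Pi.add_apply, Pi.smul_apply]
    module
  simp only [tripleForm, tripleSq, h, inner_add_left, real_inner_smul_left,
    real_inner_self_eq_norm_sq]
  ring

theorem tripleSq_add_smul (j k l : Fin N) (x y : Config N) (t : ℝ) :
    tripleSq j k l (x + t • y) =
      tripleSq j k l x + 2 * t * tripleForm j k l x y + t ^ 2 * tripleSq j k l y := by
  have h (j k : Fin N) : (x + t • y) j - (x + t • y) k = (x j - x k) + t • (y j - y k) := by
    simp only [Pi.add_apply, Pi.smul_apply]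
    module
  simp only [tripleForm, tripleSq, h, norm_add_sq_real, real_inner_smul_right, norm_smul, mul_pow,
    Real.norm_eq_abs, sq_abs]
  ring

theorem sum_eq_add_add {ι M : Type*} [Fintype ι] [AddCommMonoid M] {j k l : ι}
    (hjk : j ≠ k) (hkl : k ≠ l) (hlj : l ≠ j) {f : ι → M}
    (hf : ∀ i, i ≠ j → i ≠ k → i ≠ l → f i = 0) : ∑ i, f i = f j + f k + f l := by
  classical
  rw [← Finset.sum_subset (Finset.subset_univ {j, k, l}) (by simpa using hf),
    Finset.sum_insert (by simp [hjk, hlj.symm]), Finset.sum_insert (by simp [hkl]),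
    Finset.sum_singleton, add_assoc]

theorem sum_tripleSq_unitVec {j k l : Fin N} (hjk : j ≠ k) (hkl : k ≠ l) (hlj : l ≠ j) :
    ∑ i, ∑ a, tripleSq j k l (unitVec i a) = 12 := by
  rw [sum_eq_add_add hjk hkl hlj fun i hj hk hl => by
    simp [tripleSq, unitVec, hj.symm, hk.symm, hl.symm]]
  norm_num [tripleSq, unitVec, hjk, hkl, hlj, hjk.symm, hkl.symm, hlj.symm]

theorem sum_tripleForm_unitVec_sq {j k l : Fin N} (hjk : j ≠ k) (hkl : k ≠ l) (hlj : l ≠ j)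
    (x : Config N) :
    ∑ i, ∑ a, tripleForm j k l x (unitVec i a) ^ 2 = 3 * tripleSq j k l x := by
  rw [sum_eq_add_add hjk hkl hlj fun i hj hk hl => by
    simp [tripleForm, unitVec, hj.symm, hk.symm, hl.symm]]
  simp only [tripleForm, tripleSq, unitVec, Pi.single_eq_same, ne_eq, hjk, hkl, hlj, hjk.symm,
    hkl.symm, hlj.symm, not_false_eq_true, Pi.single_eq_of_ne, sub_zero, zero_sub, sub_self,
    inner_zero_right, inner_neg_right, neg_sub, EuclideanSpace.inner_single_right, PiLp.sub_apply,
    Real.ringHom_apply, one_mul, add_zero, zero_add, Fin.sum_univ_two, EuclideanSpace.norm_sq_eq,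
    Real.norm_eq_abs, sq_abs]
  ring

/-- The `a`-th coordinate at the particle `i` of the vector field `∇ρ² / (2ρ²)`. -/
def tripleField (j k l i : Fin N) (a : Fin 2) (x : Config N) : ℝ :=
  tripleForm j k l x (unitVec i a) / tripleSq j k l x

section TripleField

variable {j k l : Fin N} {x : Config N}

theorem contDiffAt_tripleField (hjk : j ≠ k) (l i : Fin N) (a : Fin 2) (hx : x ∉ diagonal N) :
    ContDiffAt ℝ ∞ (tripleField j k l i a) x :=
  (contDiff_tripleForm j k l _).contDiffAt.div (contDiff_tripleSq j k l).contDiffAt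
    (tripleSq_pos hjk l hx).ne'

theorem fderiv_tripleField (hjk : j ≠ k) (l i : Fin N) (a : Fin 2) (hx : x ∉ diagonal N) :
    fderiv ℝ (tripleField j k l i a) x (unitVec i a) =
      tripleSq j k l (unitVec i a) / tripleSq j k l x - 2 * tripleField j k l i a x ^ 2 := by
  have hρ := (tripleSq_pos hjk l hx).ne'
  set e : Config N := unitVec i a with he
  have hform : HasDerivAt (fun t : ℝ => tripleForm j k l (x + t • e) e) (tripleSq j k l e) 0 := by
    simp only [tripleForm_add_smul]
    simpa using ((hasDerivAt_id (0 : ℝ)).mul_const (tripleSq j k l e)).const_add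
      (tripleForm j k l x e)
  have hsq : HasDerivAt (fun t : ℝ => tripleSq j k l (x + t • e)) (2 * tripleForm j k l x e) 0 := by
    simp only [tripleSq_add_smul]
    have h := ((((hasDerivAt_id (0 : ℝ)).const_mul 2).mul_const (tripleForm j k l x e)).const_add
      (tripleSq j k l x)).add ((hasDerivAt_pow 2 (0 : ℝ)).mul_const (tripleSq j k l e))
    exact h.congr_deriv (by simp)
  rw [← ((contDiffAt_tripleField hjk l i a hx).differentiableAt (by simp)).lineDeriv_eq_fderiv]
  refine ((hform.div hsq (by simpa using hρ)).deriv).trans ?_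
  simp only [zero_smul, add_zero, tripleField, ← he]
  field_simp

theorem sum_fderiv_tripleField_sub_sq (hjk : j ≠ k) (hkl : k ≠ l) (hlj : l ≠ j)
    (hx : x ∉ diagonal N) :
    ∑ i, ∑ a, (fderiv ℝ (tripleField j k l i a) x (unitVec i a) - tripleField j k l i a x ^ 2) =
      3 / tripleSq j k l x := by
  have hρ := (tripleSq_pos hjk l hx).ne'
  have h (i : Fin N) (a : Fin 2) : fderiv ℝ (tripleField j k l i a) x (unitVec i a) -
      tripleField j k l i a x ^ 2 = tripleSq j k l (unitVec i a) / tripleSq j k l x -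
        3 / tripleSq j k l x ^ 2 * tripleForm j k l x (unitVec i a) ^ 2 := by
    rw [fderiv_tripleField hjk l i a hx, tripleField]
    ring
  simp only [h, Finset.sum_sub_distrib, ← Finset.sum_div, ← Finset.mul_sum,
    sum_tripleSq_unitVec hjk hkl hlj, sum_tripleForm_unitVec_sq hjk hkl hlj]
  field_simp
  norm_num

end TripleField

theorem IsTest.integral_inv_tripleSq_mul_norm_sq_le {φ : Config N → ℂ} (hφ : IsTest φ) (α : ℝ)
    {j k l : Fin N} (hjk : j ≠ k) (hkl : k ≠ l) (hlj : l ≠ j) :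
    ∫ x, (tripleSq j k l x)⁻¹ * ‖φ x‖ ^ 2 ≤
      ∑ i, ∑ a, ∫ x, ‖Anyon.magneticDeriv α i a φ x‖ ^ 2 := by
  have hF (i : Fin N) (a : Fin 2) : Integrable fun x =>
      (fderiv ℝ (tripleField j k l i a) x (unitVec i a) - tripleField j k l i a x ^ 2) *
        ‖φ x‖ ^ 2 :=
    hφ.integrable_mul_norm_sq fun x hx =>
      have h := contDiffAt_tripleField hjk l i a hx
      ((h.fderiv_right (m := ∞) (by simp)).clm_apply contDiffAt_const).sub (h.pow 2)
  have hsum (x : Config N) : (tripleSq j k l x)⁻¹ * ‖φ x‖ ^ 2 ≤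
      ∑ i, ∑ a, (fderiv ℝ (tripleField j k l i a) x (unitVec i a) - tripleField j k l i a x ^ 2) *
        ‖φ x‖ ^ 2 := by
    by_cases hx : x ∈ diagonal N
    · simp [hφ.apply_eq_zero hx]
    · simp only [← Finset.sum_mul, sum_fderiv_tripleField_sub_sq hjk hkl hlj hx]
      have := tripleSq_pos hjk l hx
      rw [← one_div]
      gcongr
      norm_num
  refine (integral_mono (hφ.integrable_mul_norm_sq fun x hx =>
    (contDiff_tripleSq j k l).contDiffAt.inv (tripleSq_pos hjk l hx).ne')
    (integrable_finsetSum _ fun i _ => integrable_finsetSum _ fun a _ => hF i a) hsum).trans ?_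
  rw [integral_finsetSum _ fun i _ => integrable_finsetSum _ fun a _ => hF i a]
  refine Finset.sum_le_sum fun i _ => ?_
  rw [integral_finsetSum _ fun a _ => hF i a]
  exact Finset.sum_le_sum fun a _ => hφ.integral_fderiv_sub_sq_mul_norm_sq_le
    (fun x hx => contDiffAt_tripleField hjk l i a hx) α i a

theorem IsTest.lintegral_enorm_sq_div_tripleSq_le {φ : Config N → ℂ} (hφ : IsTest φ) (α : ℝ)
    {j k l : Fin N} (hjk : j ≠ k) (hkl : k ≠ l) (hlj : l ≠ j) :
    ∫⁻ x, ‖φ x‖ₑ ^ 2 / ENNReal.ofReal (tripleSq j k l x) ≤ kinetic α φ := by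
  calc ∫⁻ x, ‖φ x‖ₑ ^ 2 / ENNReal.ofReal (tripleSq j k l x)
      = ∫⁻ x, ENNReal.ofReal ((tripleSq j k l x)⁻¹ * ‖φ x‖ ^ 2) := by
        refine lintegral_congr fun x => ?_
        by_cases hx : x ∈ diagonal N
        · simp [hφ.apply_eq_zero hx]
        · rw [ENNReal.ofReal_mul (inv_nonneg.2 (tripleSq_pos hjk l hx).le),
            ENNReal.ofReal_inv_of_pos (tripleSq_pos hjk l hx), ENNReal.ofReal_pow (norm_nonneg _),
            ofReal_norm, mul_comm, div_eq_mul_inv]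
    _ = ENNReal.ofReal (∫ x, (tripleSq j k l x)⁻¹ * ‖φ x‖ ^ 2) := by
        have hρ (x : Config N) : 0 ≤ tripleSq j k l x := by unfold tripleSq; positivity
        exact (ofReal_integral_eq_lintegral_ofReal (hφ.integrable_mul_norm_sq fun x hx =>
          (contDiff_tripleSq j k l).contDiffAt.inv (tripleSq_pos hjk l hx).ne')
          (.of_forall fun x => mul_nonneg (inv_nonneg.2 (hρ x)) (sq_nonneg _))).symm
    _ ≤ kinetic α φ := by
        rw [hφ.kinetic_eq]
        exact ENNReal.ofReal_le_ofReal (hφ.integral_inv_tripleSq_mul_norm_sq_le α hjk hkl hlj)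

theorem hasDerivAt_arg_one_sub_exp_mul_sq {z : ℂ} (hz : ‖z‖ < 1) (θ : ℝ) :
    HasDerivAt (fun t : ℝ => (1 - (Complex.exp (t * Complex.I) * z) ^ 2).arg)
      (Complex.exp (θ * Complex.I) * z / (Complex.exp (θ * Complex.I) * z - 1) +
        Complex.exp (θ * Complex.I) * z / (Complex.exp (θ * Complex.I) * z + 1)).re θ := by
  set ζ : ℂ := Complex.exp (θ * Complex.I) * z with hζ
  have hnorm : ‖ζ‖ < 1 := by simpa [hζ, Complex.norm_exp_ofReal_mul_I] using hz
  have hslit : 1 - ζ ^ 2 ∈ Complex.slitPlane := by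
    rw [sub_eq_add_neg]
    refine Complex.mem_slitPlane_of_norm_lt_one ?_
    rw [norm_neg, norm_pow]
    exact pow_lt_one₀ (norm_nonneg _) hnorm two_ne_zero
  have hexp : HasDerivAt (fun t : ℝ => Complex.exp (t * Complex.I) * z) (ζ * Complex.I) θ := by
    have h := (((Complex.ofRealCLM.hasDerivAt (x := θ)).mul_const Complex.I).cexp).mul_const z
    refine h.congr_deriv ?_
    rw [Complex.ofRealCLM_apply, Complex.ofRealCLM_apply, Complex.ofReal_one, one_mul, hζ]
    ring
  have hlog := ((hexp.pow 2).const_sub 1).clog_real hslit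
  have h1 : ζ - 1 ≠ 0 := fun h => by simp [sub_eq_zero.1 h] at hnorm
  have h2 : ζ + 1 ≠ 0 := fun h => by simp [eq_neg_of_add_eq_zero_left h] at hnorm
  have h3 : 1 - ζ ^ 2 ≠ 0 := Complex.slitPlane_ne_zero hslit
  have hsplit : -(2 * ζ * (ζ * Complex.I)) / (1 - ζ ^ 2) =
      Complex.I * (ζ / (ζ - 1) + ζ / (ζ + 1)) := by
    field_simp
    ring
  simp only [← Complex.log_im]
  refine (Complex.imCLM.hasFDerivAt.comp_hasDerivAt θ hlog).congr_deriv ?_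
  simp [← hζ, hsplit]

theorem exp_mul_pi_ne_one {α : ℝ} (hα : ∀ q : ℤ, α ≠ 2 * (q : ℝ)) :
    Complex.exp ((α * Real.pi : ℝ) * Complex.I) ≠ 1 := by
  intro h
  obtain ⟨q, hq⟩ := Complex.exp_eq_one_iff.1 h
  have him : α * Real.pi = q * (2 * Real.pi) := by simpa using congrArg Complex.im hq
  refine hα q (mul_right_cancel₀ Real.pi_ne_zero ?_)
  rw [him]
  ring

/-- The isometric identification of the plane with `ℂ`, sending `(x, y)` to `x + iy`. -/
def toComplex : Plane ≃ₗᵢ[ℝ] ℂ := Complex.orthonormalBasisOneI.repr.symm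

theorem toComplex_apply (v : Plane) : toComplex v = ⟨v 0, v 1⟩ := by
  simp [toComplex, Complex.ext_iff]

/-- The motion of the pair `j`, `k` that displaces `j` by `w` and `k` by `-w`. -/
def pairShift (j k : Fin N) : ℂ →L[ℝ] Config N :=
  (ContinuousLinearMap.single ℝ (fun _ => Plane) j -
    ContinuousLinearMap.single ℝ (fun _ => Plane) k) ∘L toComplex.symm.toContinuousLinearEquiv

/-- The position of the particle `j` relative to the midpoint of `j` and `k`. -/
def halfDiff (j k : Fin N) : Config N →L[ℝ] ℂ :=
  (2⁻¹ : ℝ) • toComplex.toContinuousLinearEquiv ∘L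
    (ContinuousLinearMap.proj (R := ℝ) (φ := fun _ : Fin N => Plane) j -
      ContinuousLinearMap.proj (R := ℝ) (φ := fun _ : Fin N => Plane) k)

/-- The position of the particle `l` relative to the midpoint of `j` and `k`. -/
def relPos (j k l : Fin N) : Config N →L[ℝ] ℂ :=
  halfDiff l j + halfDiff l k

/-- The rotation of the pair `j`, `k` by the angle `θ` about its midpoint. -/
def pairRot (j k : Fin N) (θ : ℝ) : Config N →L[ℝ] Config N :=
  ContinuousLinearMap.id ℝ (Config N) +
    pairShift j k ∘L ContinuousLinearMap.mul ℝ ℂ (Complex.exp (θ * Complex.I) - 1) ∘L halfDiff j k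

/-- The configurations in which no other particle lies in the disc with diameter `x_j x_k`. -/
def pairAlone (j k : Fin N) : Set (Config N) :=
  {x | ∀ l, l ≠ j → l ≠ k → ‖halfDiff j k x‖ < ‖relPos j k l x‖}

section Pair

variable {j k l : Fin N}

theorem pairShift_apply_of_ne (hlj : l ≠ j) (hlk : l ≠ k) (w : ℂ) : pairShift j k w l = 0 := by
  simp [pairShift, hlj, hlk]

theorem toComplex_pairShift_left (hjk : j ≠ k) (w : ℂ) : toComplex (pairShift j k w j) = w := by
  simp [pairShift, hjk]

theorem toComplex_pairShift_right (hjk : j ≠ k) (w : ℂ) :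
    toComplex (pairShift j k w k) = -w := by
  simp [pairShift, hjk.symm]

theorem halfDiff_apply (j k : Fin N) (x : Config N) :
    halfDiff j k x = (toComplex (x j) - toComplex (x k)) / 2 := by
  rw [show halfDiff j k x = (2⁻¹ : ℝ) • (toComplex (x j - x k)) from rfl, map_sub,
    Complex.real_smul, Complex.ofReal_inv, Complex.ofReal_ofNat, div_eq_inv_mul]

theorem relPos_apply (j k l : Fin N) (x : Config N) :
    relPos j k l x = toComplex (x l) - (toComplex (x j) + toComplex (x k)) / 2 := by
  simp only [relPos, add_apply, halfDiff_apply]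
  ring

theorem pairRot_apply (j k : Fin N) (θ : ℝ) (x : Config N) :
    pairRot j k θ x = x + pairShift j k ((Complex.exp (θ * Complex.I) - 1) * halfDiff j k x) := rfl

theorem halfDiff_pairRot (hjk : j ≠ k) (θ : ℝ) (x : Config N) :
    halfDiff j k (pairRot j k θ x) = Complex.exp (θ * Complex.I) * halfDiff j k x := by
  have hshift (w : ℂ) : halfDiff j k (pairShift j k w) = w := by
    rw [halfDiff_apply, toComplex_pairShift_left hjk, toComplex_pairShift_right hjk]
    ring
  rw [pairRot_apply, map_add, hshift]
  ring

theorem relPos_pairRot (hjk : j ≠ k) (hlj : l ≠ j) (hlk : l ≠ k) (θ : ℝ) (x : Config N) :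
    relPos j k l (pairRot j k θ x) = relPos j k l x := by
  have hshift (w : ℂ) : relPos j k l (pairShift j k w) = 0 := by
    rw [relPos_apply, toComplex_pairShift_left hjk, toComplex_pairShift_right hjk,
      pairShift_apply_of_ne hlj hlk]
    simp
  rw [pairRot_apply, map_add, hshift, add_zero]

theorem norm_halfDiff_pairRot (hjk : j ≠ k) (θ : ℝ) (x : Config N) :
    ‖halfDiff j k (pairRot j k θ x)‖ = ‖halfDiff j k x‖ := by
  rw [halfDiff_pairRot hjk, norm_mul, Complex.norm_exp_ofReal_mul_I, one_mul]

theorem pairRot_mem_pairAlone_iff (hjk : j ≠ k) (θ : ℝ) {x : Config N} :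
    pairRot j k θ x ∈ pairAlone j k ↔ x ∈ pairAlone j k :=
  forall_congr' fun l => forall_congr' fun hlj => forall_congr' fun hlk => by
    rw [norm_halfDiff_pairRot hjk, relPos_pairRot hjk hlj hlk]

theorem pairRot_zero (j k : Fin N) (x : Config N) : pairRot j k 0 x = x := by
  simp [pairRot_apply]

theorem pairRot_pi (hjk : j ≠ k) (x : Config N) :
    pairRot j k Real.pi x = x ∘ Equiv.swap j k := by
  funext l
  apply toComplex.injective
  rw [pairRot_apply, Pi.add_apply, map_add, Complex.exp_pi_mul_I, halfDiff_apply,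
    Function.comp_apply]
  rcases eq_or_ne l j with rfl | hlj
  · rw [toComplex_pairShift_left hjk, Equiv.swap_apply_left]
    ring
  rcases eq_or_ne l k with rfl | hlk
  · rw [toComplex_pairShift_right hjk, Equiv.swap_apply_right]
    ring
  · rw [pairShift_apply_of_ne hlj hlk, Equiv.swap_apply_of_ne_of_ne hlj hlk, map_zero, add_zero]

theorem norm_sub_eq_two_mul_norm_halfDiff (j k : Fin N) (x : Config N) :
    ‖x j - x k‖ = 2 * ‖halfDiff j k x‖ := by
  rw [halfDiff_apply, ← map_sub, norm_div, LinearIsometryEquiv.norm_map,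
    Complex.norm_ofNat, mul_div_cancel₀ _ two_ne_zero]

theorem tripleSq_eq (j k l : Fin N) (x : Config N) :
    tripleSq j k l x = 6 * ‖halfDiff j k x‖ ^ 2 + 2 * ‖relPos j k l x‖ ^ 2 := by
  have hk : toComplex (x k - x l) = -(halfDiff j k x + relPos j k l x) := by
    rw [halfDiff_apply, relPos_apply, map_sub]
    ring
  have hj : toComplex (x l - x j) = relPos j k l x - halfDiff j k x := by
    rw [halfDiff_apply, relPos_apply, map_sub]
    ring
  rw [tripleSq, norm_sub_eq_two_mul_norm_halfDiff, ← toComplex.norm_map (x k - x l),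
    ← toComplex.norm_map (x l - x j), hk, hj, norm_neg]
  have := parallelogram_law_with_norm ℝ (relPos j k l x) (halfDiff j k x)
  rw [add_comm (halfDiff j k x)]
  linarith

theorem sum_norm_sq_pairRot (hjk : j ≠ k) (θ : ℝ) (x : Config N) :
    ∑ i, ‖pairRot j k θ x i‖ ^ 2 = ∑ i, ‖x i‖ ^ 2 := by
  have hpair (y : Config N) : ‖y j‖ ^ 2 + ‖y k‖ ^ 2 =
      2 * (‖(toComplex (y j) + toComplex (y k)) / 2‖ ^ 2 + ‖halfDiff j k y‖ ^ 2) := by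
    have h := parallelogram_law_with_norm ℝ ((toComplex (y j) + toComplex (y k)) / 2)
      (halfDiff j k y)
    have hj : (toComplex (y j) + toComplex (y k)) / 2 + halfDiff j k y = toComplex (y j) := by
      rw [halfDiff_apply]
      ring
    have hk : (toComplex (y j) + toComplex (y k)) / 2 - halfDiff j k y = toComplex (y k) := by
      rw [halfDiff_apply]
      ring
    rw [hj, hk, LinearIsometryEquiv.norm_map, LinearIsometryEquiv.norm_map] at h
    linarith
  have hsplit (y : Config N) : ∑ i, ‖y i‖ ^ 2 =
      ‖y j‖ ^ 2 + ‖y k‖ ^ 2 + ∑ i ∈ (Finset.univ.erase j).erase k, ‖y i‖ ^ 2 := by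
    rw [← Finset.add_sum_erase _ _ (Finset.mem_univ j),
      ← Finset.add_sum_erase _ _ (Finset.mem_erase.2 ⟨hjk.symm, Finset.mem_univ k⟩), add_assoc]
  have hcenter : toComplex (pairRot j k θ x j) + toComplex (pairRot j k θ x k) =
      toComplex (x j) + toComplex (x k) := by
    simp only [pairRot_apply, Pi.add_apply, map_add, toComplex_pairShift_left hjk,
      toComplex_pairShift_right hjk]
    ring
  rw [hsplit, hsplit, hpair, hpair, hcenter, norm_halfDiff_pairRot hjk]
  congr 1
  refine Finset.sum_congr rfl fun i hi => ?_
  rw [Finset.mem_erase, Finset.mem_erase] at hi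
  rw [pairRot_apply, Pi.add_apply, pairShift_apply_of_ne hi.2.1 hi.1, add_zero]

theorem measurePreserving_pairRot (hjk : j ≠ k) (θ : ℝ) :
    MeasurePreserving (pairRot j k θ) := by
  have hcont : Continuous fun x : Config N => ∑ i, ‖x i‖ ^ 2 := by fun_prop
  refine measurePreserving_of_preimage_eq volume (pairRot j k θ).toLinearMap
    (s := {x | ∑ i, ‖x i‖ ^ 2 < 1}) ?_ ?_ ?_
  · exact (isOpen_lt hcont continuous_const).mem_nhds (by simp)
  · refine (Metric.isBounded_closedBall (x := (0 : Config N)) (r := 1)).subset fun x hx => ?_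
    rw [mem_closedBall_zero_iff, pi_norm_le_iff_of_nonneg zero_le_one]
    refine fun i => (sq_le_one_iff₀ (norm_nonneg _)).1 (le_trans ?_ (le_of_lt hx))
    exact Finset.single_le_sum (f := fun i => ‖x i‖ ^ 2) (fun i _ => sq_nonneg _)
      (Finset.mem_univ i)
  · ext x
    simp [sum_norm_sq_pairRot hjk]

end Pair

/-- The gauge phase that removes from the configurations in `pairAlone j k` the effect of the other
particles on the angular momentum of the pair; `(1 - ζ²)` with `|ζ| < 1` avoids the branch cut. -/
def pairPhase (j k : Fin N) (x : Config N) : ℝ :=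
  ∑ l ∈ (Finset.univ.erase j).erase k, (1 - (halfDiff j k x / relPos j k l x) ^ 2).arg

/-- The covariant derivative of `φ` along the rotation of the pair `j`, `k` about its midpoint,
up to a factor `i`: the coordinates of this velocity of `j` are the real and imaginary parts of
`i * halfDiff j k x`. -/
def angularDeriv (α : ℝ) (j k : Fin N) (φ : Config N → ℂ) (x : Config N) : ℂ :=
  (halfDiff j k x).re * (magneticDeriv α j 1 φ x - magneticDeriv α k 1 φ x) -
    (halfDiff j k x).im * (magneticDeriv α j 0 φ x - magneticDeriv α k 0 φ x)

section Pair

variable {j k : Fin N}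

theorem vectorPotential_dot_perp (z : ℂ) (x : Config N) :
    z.re * vectorPotential j x 1 - z.im * vectorPotential j x 0 =
      ∑ l ∈ Finset.univ.erase j, (z / (toComplex (x j) - toComplex (x l))).re := by
  simp only [vectorPotential, WithLp.ofLp_sum, Finset.sum_apply, PiLp.smul_apply, smul_eq_mul,
    Finset.mul_sum, ← Finset.sum_sub_distrib]
  refine Finset.sum_congr rfl fun l _ => ?_
  rw [← map_sub, Complex.div_re, Complex.normSq_eq_norm_sq, LinearIsometryEquiv.norm_map,
    toComplex_apply]
  simp only [perp, PiLp.toLp_apply, Matrix.cons_val_zero, Matrix.cons_val_one]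
  ring

theorem halfDiff_dot_perp_vectorPotential_sub (hjk : j ≠ k) {x : Config N} (hx : x j ≠ x k) :
    (halfDiff j k x).re * (vectorPotential j x 1 - vectorPotential k x 1) -
      (halfDiff j k x).im * (vectorPotential j x 0 - vectorPotential k x 0) =
    1 + ∑ l ∈ (Finset.univ.erase j).erase k,
      ((halfDiff j k x / (toComplex (x j) - toComplex (x l))).re -
        (halfDiff j k x / (toComplex (x k) - toComplex (x l))).re) := by
  set v := halfDiff j k x with hv
  have hv0 : v ≠ 0 := by
    rw [← sub_ne_zero, ← norm_ne_zero_iff, norm_sub_eq_two_mul_norm_halfDiff] at hx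
    exact norm_ne_zero_iff.1 (right_ne_zero_of_mul hx)
  have hj : toComplex (x j) - toComplex (x k) = 2 * v := by
    rw [hv, halfDiff_apply]
    ring
  have hk : toComplex (x k) - toComplex (x j) = -(2 * v) := by
    rw [← hj, neg_sub]
  have hpair : (v / (2 * v)).re - (v / -(2 * v)).re = 1 := by
    rw [div_neg, div_mul_cancel_right₀ hv0]
    norm_num
  have hj' := vectorPotential_dot_perp (j := j) v x
  have hk' := vectorPotential_dot_perp (j := k) v x
  rw [← Finset.add_sum_erase _ _ (Finset.mem_erase.2 ⟨hjk.symm, Finset.mem_univ k⟩), hj] at hj'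
  rw [← Finset.add_sum_erase _ _ (Finset.mem_erase.2 ⟨hjk, Finset.mem_univ j⟩), hk,
    Finset.erase_right_comm] at hk'
  rw [Finset.sum_sub_distrib]
  linear_combination hj' - hk' + hpair

theorem re_halfDiff_div_sub_re_halfDiff_div {x : Config N} {l : Fin N} (hl : relPos j k l x ≠ 0) :
    (halfDiff j k x / (toComplex (x j) - toComplex (x l))).re -
        (halfDiff j k x / (toComplex (x k) - toComplex (x l))).re =
      (halfDiff j k x / relPos j k l x / (halfDiff j k x / relPos j k l x - 1) +
        halfDiff j k x / relPos j k l x / (halfDiff j k x / relPos j k l x + 1)).re := by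
  set v := halfDiff j k x with hv
  set w := relPos j k l x with hw
  have hjl : toComplex (x j) - toComplex (x l) = v - w := by
    rw [hv, hw, halfDiff_apply, relPos_apply]
    ring
  have hkl : toComplex (x k) - toComplex (x l) = -(v + w) := by
    rw [hv, hw, halfDiff_apply, relPos_apply]
    ring
  rw [hjl, hkl, ← Complex.sub_re, div_neg, sub_neg_eq_add, div_sub_one hl, div_add_one hl,
    div_div_div_cancel_right₀ hl, div_div_div_cancel_right₀ hl]

theorem fderiv_pairShift (α : ℝ) (φ : Config N → ℂ) (x : Config N) :
    fderiv ℝ φ x (pairShift j k (halfDiff j k x * Complex.I)) =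
      Complex.I * angularDeriv α j k φ x - Complex.I * α *
        ((halfDiff j k x).re * (vectorPotential j x 1 - vectorPotential k x 1) -
          (halfDiff j k x).im * (vectorPotential j x 0 - vectorPotential k x 0) : ℝ) * φ x := by
  have hsymm (z : ℂ) : toComplex.symm z =
      z.re • EuclideanSpace.single 0 1 + z.im • EuclideanSpace.single 1 1 := by
    rw [LinearIsometryEquiv.symm_apply_eq, toComplex_apply]
    simp
  have hshift (z : ℂ) : pairShift j k z =
      z.re • (unitVec j 0 - unitVec k 0) + z.im • (unitVec j 1 - unitVec k 1) := by
    have : pairShift j k z = Pi.single j (toComplex.symm z) - Pi.single k (toComplex.symm z) := rfl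
    simp only [this, hsymm, unitVec, Pi.single_add, Pi.single_smul]
    module
  simp only [hshift, map_add, map_sub, map_smul, angularDeriv, magneticDeriv, partialDeriv,
    Complex.real_smul, Complex.mul_re, Complex.mul_im, Complex.I_re, Complex.I_im]
  push_cast
  linear_combination (((halfDiff j k x).re : ℂ) * (fderiv ℝ φ x (unitVec j 1) -
    fderiv ℝ φ x (unitVec k 1)) - (halfDiff j k x).im * (fderiv ℝ φ x (unitVec j 0) -
    fderiv ℝ φ x (unitVec k 0))) * Complex.I_sq

theorem enorm_angularDeriv_sq_le (hjk : j ≠ k) (α : ℝ) (φ : Config N → ℂ) (x : Config N) :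
    ‖angularDeriv α j k φ x‖ₑ ^ 2 ≤ ‖x j - x k‖ₑ ^ 2 * kineticDensity α φ x := by
  set v := halfDiff j k x with hv
  have hnorm : ‖x j - x k‖ₑ ^ 2 = 4 * ‖v‖ₑ ^ 2 := by
    rw [← ofReal_norm, norm_sub_eq_two_mul_norm_halfDiff, ENNReal.ofReal_mul zero_le_two,
      ofReal_norm, mul_pow, ← hv]
    norm_num
  have hre : ‖(v.re : ℂ)‖ₑ ≤ ‖v‖ₑ := by
    rw [enorm_le_iff_norm_le, Complex.norm_real]
    exact Complex.abs_re_le_norm v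
  have him : ‖(v.im : ℂ)‖ₑ ≤ ‖v‖ₑ := by
    rw [enorm_le_iff_norm_le, Complex.norm_real]
    exact Complex.abs_im_le_norm v
  calc ‖angularDeriv α j k φ x‖ₑ ^ 2
      ≤ (‖v‖ₑ * ∑ p ∈ {j, k} ×ˢ Finset.univ, ‖magneticDeriv α p.1 p.2 φ x‖ₑ) ^ 2 := by
        gcongr
        rw [Finset.sum_product, Finset.sum_pair hjk, Fin.sum_univ_two, Fin.sum_univ_two]
        calc ‖angularDeriv α j k φ x‖ₑ
            ≤ ‖v‖ₑ * (‖magneticDeriv α j 1 φ x‖ₑ + ‖magneticDeriv α k 1 φ x‖ₑ) +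
              ‖v‖ₑ * (‖magneticDeriv α j 0 φ x‖ₑ + ‖magneticDeriv α k 0 φ x‖ₑ) := by
              refine (enorm_sub_le).trans ?_
              rw [enorm_mul, enorm_mul]
              gcongr <;> exact enorm_sub_le
          _ = _ := by ring
    _ ≤ ‖v‖ₑ ^ 2 * (4 * ∑ p ∈ {j, k} ×ˢ Finset.univ, ‖magneticDeriv α p.1 p.2 φ x‖ₑ ^ 2) := by
        rw [mul_pow]
        gcongr
        refine (sq_sum_le _ _).trans_eq ?_
        simp [Finset.card_pair hjk]
    _ ≤ ‖x j - x k‖ₑ ^ 2 * kineticDensity α φ x := by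
        rw [hnorm, kineticDensity, mul_left_comm, mul_assoc, Finset.sum_product]
        gcongr
        exact Finset.subset_univ _

end Pair

theorem enorm_I : ‖Complex.I‖ₑ = 1 := by rw [← ofReal_norm, Complex.norm_I, ENNReal.ofReal_one]

theorem enorm_ofReal (r : ℝ) : ‖(r : ℂ)‖ₑ = ‖r‖ₑ := by
  rw [← ofReal_norm, Complex.norm_real, ofReal_norm]

section Pair

variable {j k : Fin N}

theorem hasDerivAt_pairRot (j k : Fin N) (x : Config N) (θ : ℝ) :
    HasDerivAt (fun t => pairRot j k t x)
      (pairShift j k (Complex.exp (θ * Complex.I) * halfDiff j k x * Complex.I)) θ := by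
  have hexp := ((Complex.ofRealCLM.hasDerivAt (x := θ)).mul_const Complex.I).cexp
  have h := (pairShift j k).hasFDerivAt.comp_hasDerivAt θ
    ((hexp.sub_const 1).mul_const (halfDiff j k x))
  refine (h.const_add x).congr_deriv ?_
  congr 1
  simp only [Complex.ofRealCLM_apply, Complex.ofReal_one]
  ring

theorem norm_sub_pairRot (hjk : j ≠ k) (θ : ℝ) (x : Config N) :
    ‖pairRot j k θ x j - pairRot j k θ x k‖ = ‖x j - x k‖ := by
  rw [norm_sub_eq_two_mul_norm_halfDiff, norm_halfDiff_pairRot hjk,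
    norm_sub_eq_two_mul_norm_halfDiff]

theorem pairPhase_pairRot (hjk : j ≠ k) (θ : ℝ) (x : Config N) :
    pairPhase j k (pairRot j k θ x) = ∑ l ∈ (Finset.univ.erase j).erase k,
      (1 - (Complex.exp (θ * Complex.I) * (halfDiff j k x / relPos j k l x)) ^ 2).arg := by
  refine Finset.sum_congr rfl fun l hl => ?_
  rw [Finset.mem_erase, Finset.mem_erase] at hl
  rw [halfDiff_pairRot hjk, relPos_pairRot hjk hl.2.1 hl.1, mul_div_assoc]

theorem pairPhase_pairRot_pi (hjk : j ≠ k) (x : Config N) :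
    pairPhase j k (pairRot j k Real.pi x) = pairPhase j k x := by
  rw [pairPhase_pairRot hjk, Complex.exp_pi_mul_I]
  simp only [neg_one_mul, neg_sq, pairPhase]

theorem hasDerivAt_add_pairPhase_pairRot (hjk : j ≠ k) {x : Config N} (hx : x j ≠ x k)
    (hmem : x ∈ pairAlone j k) (θ : ℝ) :
    HasDerivAt (fun t => t + pairPhase j k (pairRot j k t x))
      ((halfDiff j k (pairRot j k θ x)).re *
          (vectorPotential j (pairRot j k θ x) 1 - vectorPotential k (pairRot j k θ x) 1) -
        (halfDiff j k (pairRot j k θ x)).im *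
          (vectorPotential j (pairRot j k θ x) 0 - vectorPotential k (pairRot j k θ x) 0)) θ := by
  have hne : pairRot j k θ x j ≠ pairRot j k θ x k := by
    rwa [← sub_ne_zero, ← norm_ne_zero_iff, norm_sub_pairRot hjk, norm_ne_zero_iff, sub_ne_zero]
  rw [halfDiff_dot_perp_vectorPotential_sub hjk hne]
  simp only [pairPhase_pairRot hjk]
  refine (hasDerivAt_id θ).add (HasDerivAt.fun_sum fun l hl => ?_)
  rw [Finset.mem_erase, Finset.mem_erase] at hl
  have hlt := hmem l hl.2.1 hl.1
  have hpos : 0 < ‖relPos j k l x‖ := (norm_nonneg _).trans_lt hlt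
  have hrel := relPos_pairRot hjk hl.2.1 hl.1 θ x
  rw [re_halfDiff_div_sub_re_halfDiff_div (by rwa [hrel, ← norm_pos_iff]), hrel,
    halfDiff_pairRot hjk, mul_div_assoc]
  refine hasDerivAt_arg_one_sub_exp_mul_sq ?_ θ
  rw [norm_div]
  exact (div_lt_one hpos).2 hlt

/-- The wave function along the rotation of the pair `j`, `k`, in the gauge in which the vector
potential has no component in the direction of this rotation. -/
def gauged (α : ℝ) (j k : Fin N) (φ : Config N → ℂ) (x : Config N) (θ : ℝ) : ℂ :=
  Complex.exp ((α * (θ + pairPhase j k (pairRot j k θ x)) : ℝ) * Complex.I) *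
    φ (pairRot j k θ x)

theorem hasDerivAt_gauged (hjk : j ≠ k) {x : Config N} (hx : x j ≠ x k)
    (hmem : x ∈ pairAlone j k) (α : ℝ) {φ : Config N → ℂ} (hφ : Differentiable ℝ φ) (θ : ℝ) :
    HasDerivAt (gauged α j k φ x)
      (Complex.exp ((α * (θ + pairPhase j k (pairRot j k θ x)) : ℝ) * Complex.I) * Complex.I *
        angularDeriv α j k φ (pairRot j k θ x)) θ := by
  have hphase := Complex.ofRealCLM.hasFDerivAt.comp_hasDerivAt θ
    ((hasDerivAt_add_pairPhase_pairRot hjk hx hmem θ).const_mul α)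
  have hcomp := (hφ _).hasFDerivAt.comp_hasDerivAt θ (hasDerivAt_pairRot j k x θ)
  rw [← halfDiff_pairRot hjk, fderiv_pairShift α] at hcomp
  refine ((hphase.mul_const Complex.I).cexp.mul hcomp).congr_deriv ?_
  simp only [Complex.ofRealCLM_apply, Function.comp_apply]
  push_cast
  ring

theorem continuous_pairRot (j k : Fin N) :
    Continuous (Function.uncurry fun θ x => pairRot j k θ x) := by
  simp only [Function.uncurry_def, pairRot_apply]
  fun_prop

theorem continuous_pairRot_left (j k : Fin N) (x : Config N) :
    Continuous fun θ => pairRot j k θ x :=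
  continuous_iff_continuousAt.2 fun θ => (hasDerivAt_pairRot j k x θ).continuousAt

theorem continuous_angularDeriv {φ : Config N → ℂ} (hφ : IsTest φ) (α : ℝ) (j k : Fin N) :
    Continuous (angularDeriv α j k φ) := by
  have hD (i : Fin N) (a : Fin 2) := (hφ.magneticDeriv α i a).continuous
  unfold angularDeriv
  fun_prop

theorem gauged_pi (hjk : j ≠ k) (α : ℝ) {φ : Config N → ℂ} (hφ : IsCore φ) (x : Config N) :
    gauged α j k φ x Real.pi =
      Complex.exp ((α * Real.pi : ℝ) * Complex.I) • gauged α j k φ x 0 := by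
  rw [gauged, gauged, pairPhase_pairRot_pi hjk, pairRot_pi hjk, hφ.symm, pairRot_zero, smul_eq_mul,
    ← mul_assoc, ← Complex.exp_add]
  congr 2
  push_cast
  ring

/-- The constant of the Hardy inequality for a pair with no other particle in between. -/
def hardyConst (α : ℝ) : ENNReal :=
  ((1 + ‖(Complex.exp ((α * Real.pi : ℝ) * Complex.I) - 1)⁻¹‖ₑ) * ENNReal.ofReal Real.pi) ^ 2

theorem hardyConst_ne_top (α : ℝ) : hardyConst α ≠ ⊤ := by
  unfold hardyConst
  finiteness

theorem lintegral_enorm_sq_pairRot_le (hjk : j ≠ k) {x : Config N} (hx : x j ≠ x k)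
    (hmem : x ∈ pairAlone j k) {α : ℝ} (hα : ∀ q : ℤ, α ≠ 2 * (q : ℝ)) {φ : Config N → ℂ}
    (hφ : IsCore φ) :
    ∫⁻ θ in Set.Ioc 0 Real.pi, ‖φ (pairRot j k θ x)‖ₑ ^ 2 ≤ hardyConst α *
      ∫⁻ θ in Set.Ioc 0 Real.pi, ‖angularDeriv α j k φ (pairRot j k θ x)‖ₑ ^ 2 := by
  have hphase : Differentiable ℝ fun θ => θ + pairPhase j k (pairRot j k θ x) := fun θ =>
    (hasDerivAt_add_pairPhase_pairRot hjk hx hmem θ).differentiableAt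
  have hgauge : Continuous fun θ =>
      Complex.exp ((α * (θ + pairPhase j k (pairRot j k θ x)) : ℝ) * Complex.I) * Complex.I := by
    have := hphase.continuous
    fun_prop
  have h := lintegral_enorm_sq_le_of_apply_eq_smul Real.pi_pos.le
    (hasDerivAt_gauged hjk hx hmem α hφ.isTest.differentiable)
    (hgauge.mul ((continuous_angularDeriv hφ.isTest α j k).comp
      (continuous_pairRot_left j k x)))
    (exp_mul_pi_ne_one hα) (gauged_pi hjk α hφ x)
  simpa only [gauged, hardyConst, enorm_mul, Complex.enorm_exp_ofReal_mul_I, enorm_I, one_mul,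
    sub_zero] using h

theorem measurableSet_pairAlone (j k : Fin N) : MeasurableSet (pairAlone j k) := by
  simp only [pairAlone, Set.ofPred_forall]
  exact .iInter fun l => .iInter fun _ => .iInter fun _ =>
    measurableSet_lt (halfDiff j k).continuous.norm.measurable
      (relPos j k l).continuous.norm.measurable

theorem IsTest.measurable_kineticDensity {φ : Config N → ℂ} (hφ : IsTest φ) (α : ℝ) :
    Measurable (kineticDensity α φ) :=
  Finset.measurable_fun_sum _ fun i _ => Finset.measurable_fun_sum _ fun a _ =>
    (hφ.magneticDeriv α i a).continuous.measurable.enorm.pow_const 2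

theorem lintegral_div_pairRot_le (hjk : j ≠ k) {x : Config N} (hmem : x ∈ pairAlone j k) {α : ℝ}
    (hα : ∀ q : ℤ, α ≠ 2 * (q : ℝ)) {φ : Config N → ℂ} (hφ : IsCore φ) :
    ∫⁻ θ in Set.Ioc 0 Real.pi,
        ‖φ (pairRot j k θ x)‖ₑ ^ 2 / ‖pairRot j k θ x j - pairRot j k θ x k‖ₑ ^ 2 ≤
      ∫⁻ θ in Set.Ioc 0 Real.pi, hardyConst α * kineticDensity α φ (pairRot j k θ x) := by
  have hdist (θ : ℝ) : ‖pairRot j k θ x j - pairRot j k θ x k‖ₑ = ‖x j - x k‖ₑ := by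
    rw [← ofReal_norm, norm_sub_pairRot hjk, ofReal_norm]
  simp only [hdist]
  rcases eq_or_ne (x j) (x k) with hx | hx
  · have hzero (θ : ℝ) : φ (pairRot j k θ x) = 0 :=
      hφ.isTest.apply_eq_zero ⟨j, k, hjk, sub_eq_zero.1 (enorm_eq_zero.1 (by
        rw [hdist, hx, sub_self, enorm_zero]))⟩
    simp [hzero]
  have hrot := (continuous_pairRot_left j k x).measurable
  have hK : Measurable fun θ => kineticDensity α φ (pairRot j k θ x) :=
    (hφ.isTest.measurable_kineticDensity α).comp hrot
  have hφm : Measurable fun θ => ‖φ (pairRot j k θ x)‖ₑ ^ 2 :=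
    (hφ.isTest.continuous.measurable.comp hrot).enorm.pow_const 2
  simp only [div_eq_mul_inv]
  rw [lintegral_mul_const _ hφm, ← div_eq_mul_inv]
  refine ENNReal.div_le_of_le_mul ?_
  calc ∫⁻ θ in Set.Ioc 0 Real.pi, ‖φ (pairRot j k θ x)‖ₑ ^ 2
      ≤ hardyConst α * ∫⁻ θ in Set.Ioc 0 Real.pi,
          ‖angularDeriv α j k φ (pairRot j k θ x)‖ₑ ^ 2 :=
        lintegral_enorm_sq_pairRot_le hjk hx hmem hα hφ
    _ ≤ hardyConst α * ∫⁻ θ in Set.Ioc 0 Real.pi,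
          ‖x j - x k‖ₑ ^ 2 * kineticDensity α φ (pairRot j k θ x) := by
        gcongr with θ
        rw [← hdist θ]
        exact enorm_angularDeriv_sq_le hjk α φ _
    _ = (∫⁻ θ in Set.Ioc 0 Real.pi, hardyConst α * kineticDensity α φ (pairRot j k θ x)) *
          ‖x j - x k‖ₑ ^ 2 := by
        rw [lintegral_const_mul _ hK, lintegral_const_mul _ hK]
        ring

theorem setLIntegral_pairAlone_le (hjk : j ≠ k) {α : ℝ} (hα : ∀ q : ℤ, α ≠ 2 * (q : ℝ))
    {φ : Config N → ℂ} (hφ : IsCore φ) :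
    ∫⁻ x in pairAlone j k, ‖φ x‖ₑ ^ 2 / ‖x j - x k‖ₑ ^ 2 ≤ hardyConst α * kinetic α φ := by
  have hφm := hφ.isTest.continuous.measurable
  have hK := hφ.isTest.measurable_kineticDensity α
  have hP := measurableSet_pairAlone j k
  have : NeZero (volume.restrict (Set.Ioc 0 Real.pi)) := ⟨by simp [Real.pi_pos]⟩
  rw [kinetic, ← lintegral_const_mul _ hK, ← lintegral_indicator hP]
  refine lintegral_le_of_lintegral_comp_le (ν := volume.restrict (Set.Ioc 0 Real.pi))
    (T := fun θ => pairRot j k θ) (continuous_pairRot j k).measurable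
    (measurePreserving_pairRot hjk) (Measurable.indicator (by fun_prop) hP)
    (hK.const_mul _) fun x => ?_
  by_cases hmem : x ∈ pairAlone j k
  · simpa only [Set.indicator, pairRot_mem_pairAlone_iff hjk, hmem, if_true] using
      lintegral_div_pairRot_le hjk hmem hα hφ
  · simp [Set.indicator, pairRot_mem_pairAlone_iff hjk, hmem]

theorem enorm_sq_div_le_of_notMem_pairAlone {x : Config N} (hx : x ∉ pairAlone j k) (c : ℂ) :
    ‖c‖ₑ ^ 2 / ‖x j - x k‖ₑ ^ 2 ≤ ∑ l ∈ (Finset.univ.erase j).erase k,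
      2 * (‖c‖ₑ ^ 2 / ENNReal.ofReal (tripleSq j k l x)) := by
  obtain ⟨l, hlj, hlk, hl⟩ : ∃ l, l ≠ j ∧ l ≠ k ∧ ‖relPos j k l x‖ ≤ ‖halfDiff j k x‖ := by
    simpa [pairAlone] using hx
  have hle : tripleSq j k l x ≤ 2 * ‖x j - x k‖ ^ 2 := by
    rw [tripleSq_eq, norm_sub_eq_two_mul_norm_halfDiff]
    nlinarith [norm_nonneg (relPos j k l x)]
  have hle' : ENNReal.ofReal (tripleSq j k l x) ≤ 2 * ‖x j - x k‖ₑ ^ 2 := by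
    refine (ENNReal.ofReal_le_ofReal hle).trans_eq ?_
    rw [ENNReal.ofReal_mul zero_le_two, ENNReal.ofReal_pow (norm_nonneg _), ofReal_norm,
      ENNReal.ofReal_ofNat]
  calc ‖c‖ₑ ^ 2 / ‖x j - x k‖ₑ ^ 2 = 2 * (‖c‖ₑ ^ 2 / (2 * ‖x j - x k‖ₑ ^ 2)) := by
        rw [← mul_div_assoc, ENNReal.mul_div_mul_left _ _ two_ne_zero ENNReal.ofNat_ne_top]
    _ ≤ 2 * (‖c‖ₑ ^ 2 / ENNReal.ofReal (tripleSq j k l x)) := by gcongr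
    _ ≤ _ := Finset.single_le_sum
        (f := fun l => 2 * (‖c‖ₑ ^ 2 / ENNReal.ofReal (tripleSq j k l x)))
        (fun _ _ => zero_le) (by simp [hlj, hlk])

theorem lintegral_enorm_sq_div_le (hjk : j ≠ k) {α : ℝ} (hα : ∀ q : ℤ, α ≠ 2 * (q : ℝ))
    {φ : Config N → ℂ} (hφ : IsCore φ) :
    ∫⁻ x, ‖φ x‖ₑ ^ 2 / ‖x j - x k‖ₑ ^ 2 ≤ (hardyConst α + 2 * N) * kinetic α φ := by
  have hP := measurableSet_pairAlone j k
  have hφm := hφ.isTest.continuous.measurable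
  have hmeas (l : Fin N) : Measurable fun x : Config N =>
      ‖φ x‖ₑ ^ 2 / ENNReal.ofReal (tripleSq j k l x) :=
    (hφm.enorm.pow_const 2).div (contDiff_tripleSq j k l).continuous.measurable.ennreal_ofReal
  have hcompl : ∫⁻ x in (pairAlone j k)ᶜ, ‖φ x‖ₑ ^ 2 / ‖x j - x k‖ₑ ^ 2 ≤ 2 * N * kinetic α φ :=
    calc ∫⁻ x in (pairAlone j k)ᶜ, ‖φ x‖ₑ ^ 2 / ‖x j - x k‖ₑ ^ 2
        ≤ ∫⁻ x in (pairAlone j k)ᶜ, ∑ l ∈ (Finset.univ.erase j).erase k,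
            2 * (‖φ x‖ₑ ^ 2 / ENNReal.ofReal (tripleSq j k l x)) :=
          setLIntegral_mono' hP.compl fun x hx => enorm_sq_div_le_of_notMem_pairAlone hx _
      _ ≤ ∫⁻ x, ∑ l ∈ (Finset.univ.erase j).erase k,
            2 * (‖φ x‖ₑ ^ 2 / ENNReal.ofReal (tripleSq j k l x)) := setLIntegral_le_lintegral _ _
      _ ≤ ∑ l ∈ (Finset.univ.erase j).erase k, 2 * kinetic α φ := by
          rw [lintegral_finsetSum _ fun l _ => (hmeas l).const_mul _]
          refine Finset.sum_le_sum fun l hl => ?_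
          rw [Finset.mem_erase, Finset.mem_erase] at hl
          rw [lintegral_const_mul _ (hmeas l)]
          gcongr
          exact hφ.isTest.lintegral_enorm_sq_div_tripleSq_le α hjk hl.1.symm hl.2.1
      _ ≤ 2 * N * kinetic α φ := by
          rw [Finset.sum_const, nsmul_eq_mul, mul_left_comm, mul_assoc]
          gcongr
          exact (Finset.card_le_univ _).trans_eq (Fintype.card_fin N)
  rw [← lintegral_add_compl _ hP, add_mul]
  exact add_le_add (setLIntegral_pairAlone_le hjk hα hφ) hcompl

end Pair

theorem enorm_vectorPotential_le (j : Fin N) (a : Fin 2) (x : Config N) :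
    ‖vectorPotential j x a‖ₑ ≤ ∑ k ∈ Finset.univ.erase j, ‖x j - x k‖ₑ⁻¹ := by
  have hperp (v : Plane) : ‖perp v a‖ ≤ ‖v‖ := by
    fin_cases a
    · simpa [perp] using PiLp.norm_apply_le v 1
    · exact PiLp.norm_apply_le v 0
  simp only [vectorPotential, WithLp.ofLp_sum, Finset.sum_apply, PiLp.smul_apply, smul_eq_mul]
  refine (enorm_sum_le _ _).trans (Finset.sum_le_sum fun k _ => ?_)
  rcases eq_or_ne (x j - x k) 0 with h | h
  · simp [h]
  · rw [← ofReal_norm (x j - x k), ← ENNReal.ofReal_inv_of_pos (norm_pos_iff.2 h), ← ofReal_norm,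
      norm_mul, norm_inv, norm_pow, norm_norm]
    refine ENNReal.ofReal_le_ofReal ?_
    rw [inv_mul_le_iff₀ (by positivity), sq, mul_assoc, mul_inv_cancel₀ (norm_ne_zero_iff.2 h),
      mul_one]
    exact hperp _

theorem partialDeriv_eq (α : ℝ) (j : Fin N) (a : Fin 2) (φ : Config N → ℂ) (x : Config N) :
    partialDeriv j a φ x =
      Complex.I * (magneticDeriv α j a φ x - α * (vectorPotential j x a * φ x)) := by
  rw [magneticDeriv]
  push_cast
  linear_combination partialDeriv j a φ x * Complex.I_sq

theorem enorm_partialDeriv_sq_le (α : ℝ) (j : Fin N) (a : Fin 2) (φ : Config N → ℂ)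
    (x : Config N) : ‖partialDeriv j a φ x‖ₑ ^ 2 ≤
      2 * (‖magneticDeriv α j a φ x‖ₑ ^ 2 +
        ‖α‖ₑ ^ 2 * ‖(vectorPotential j x a : ℂ) * φ x‖ₑ ^ 2) := by
  rw [partialDeriv_eq α, enorm_mul, enorm_I, one_mul]
  have h := sq_sum_le Finset.univ
    ![‖magneticDeriv α j a φ x‖ₑ, ‖α * ((vectorPotential j x a : ℂ) * φ x)‖ₑ]
  simp only [Fin.sum_univ_two, Matrix.cons_val_zero, Matrix.cons_val_one, Finset.card_univ,
    Fintype.card_fin, Nat.succ_eq_add_one, Nat.reduceAdd, Nat.cast_ofNat] at h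
  refine (pow_le_pow_left' enorm_sub_le 2).trans (h.trans_eq ?_)
  rw [enorm_mul, mul_pow, enorm_ofReal]

theorem lintegral_enorm_magneticDeriv_sq_le (α : ℝ) (φ : Config N → ℂ) (j : Fin N) (a : Fin 2) :
    ∫⁻ x, ‖magneticDeriv α j a φ x‖ₑ ^ 2 ≤ kinetic α φ :=
  lintegral_mono fun x => (Finset.single_le_sum
    (f := fun a => ‖magneticDeriv α j a φ x‖ₑ ^ 2) (fun _ _ => zero_le) (Finset.mem_univ a)).trans
    (Finset.single_le_sum (f := fun j => ∑ a, ‖magneticDeriv α j a φ x‖ₑ ^ 2)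
      (fun _ _ => zero_le) (Finset.mem_univ j))

theorem lintegral_enorm_vectorPotential_mul_sq_le {α : ℝ} (hα : ∀ q : ℤ, α ≠ 2 * (q : ℝ))
    {φ : Config N → ℂ} (hφ : IsCore φ) (j : Fin N) (a : Fin 2) :
    ∫⁻ x, ‖(vectorPotential j x a : ℂ) * φ x‖ₑ ^ 2 ≤
      N * (N * ((hardyConst α + 2 * N) * kinetic α φ)) := by
  have hφm := hφ.isTest.continuous.measurable
  have hcard : ((Finset.univ.erase j).card : ENNReal) ≤ N := by
    exact_mod_cast (Finset.card_le_univ _).trans_eq (Fintype.card_fin N)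
  calc ∫⁻ x, ‖(vectorPotential j x a : ℂ) * φ x‖ₑ ^ 2
      ≤ ∫⁻ x, N * ∑ k ∈ Finset.univ.erase j, ‖φ x‖ₑ ^ 2 / ‖x j - x k‖ₑ ^ 2 := by
        refine lintegral_mono fun x => ?_
        calc ‖(vectorPotential j x a : ℂ) * φ x‖ₑ ^ 2
            ≤ (∑ k ∈ Finset.univ.erase j, ‖φ x‖ₑ * ‖x j - x k‖ₑ⁻¹) ^ 2 := by
              rw [enorm_mul, mul_comm, ← Finset.mul_sum, enorm_ofReal]
              gcongr
              exact enorm_vectorPotential_le j a x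
          _ ≤ _ := by
              refine (sq_sum_le _ _).trans ?_
              simp only [mul_pow, ENNReal.inv_pow, div_eq_mul_inv]
              gcongr
    _ = N * ∑ k ∈ Finset.univ.erase j, ∫⁻ x, ‖φ x‖ₑ ^ 2 / ‖x j - x k‖ₑ ^ 2 := by
        rw [lintegral_const_mul _ (by fun_prop), lintegral_finsetSum _ fun k _ => by fun_prop]
    _ ≤ N * ∑ k ∈ Finset.univ.erase j, (hardyConst α + 2 * N) * kinetic α φ := by
        gcongr with k hk
        exact lintegral_enorm_sq_div_le (Finset.ne_of_mem_erase hk).symm hα hφ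
    _ ≤ N * (N * ((hardyConst α + 2 * N) * kinetic α φ)) := by
        rw [Finset.sum_const, nsmul_eq_mul]
        gcongr

theorem exists_lintegral_enorm_partialDeriv_sq_le (N : ℕ) {α : ℝ}
    (hα : ∀ q : ℤ, q ≠ 0 → α ≠ 2 * (q : ℝ)) :
    ∃ C : ENNReal, C ≠ ⊤ ∧ ∀ φ : Config N → ℂ, IsCore φ → ∀ j a,
      ∫⁻ x, ‖partialDeriv j a φ x‖ₑ ^ 2 ≤ C * kinetic α φ := by
  rcases eq_or_ne α 0 with rfl | h0
  · refine ⟨1, ENNReal.one_ne_top, fun φ _ j a => ?_⟩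
    simpa [partialDeriv_eq 0, enorm_mul, enorm_I] using lintegral_enorm_magneticDeriv_sq_le 0 φ j a
  have hα' (q : ℤ) : α ≠ 2 * (q : ℝ) := by
    rcases eq_or_ne q 0 with rfl | hq
    · simpa using h0
    · exact hα q hq
  have hhardy := hardyConst_ne_top α
  refine ⟨2 * (1 + ‖α‖ₑ ^ 2 * (N * (N * (hardyConst α + 2 * N)))), by finiteness,
    fun φ hφ j a => ?_⟩
  have hDm := (hφ.isTest.magneticDeriv α j a).continuous.measurable.enorm.pow_const 2
  calc ∫⁻ x, ‖partialDeriv j a φ x‖ₑ ^ 2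
      ≤ ∫⁻ x, 2 * (‖magneticDeriv α j a φ x‖ₑ ^ 2 +
          ‖α‖ₑ ^ 2 * ‖(vectorPotential j x a : ℂ) * φ x‖ₑ ^ 2) :=
        lintegral_mono fun x => enorm_partialDeriv_sq_le α j a φ x
    _ = 2 * ((∫⁻ x, ‖magneticDeriv α j a φ x‖ₑ ^ 2) +
          ‖α‖ₑ ^ 2 * ∫⁻ x, ‖(vectorPotential j x a : ℂ) * φ x‖ₑ ^ 2) := by
        rw [lintegral_const_mul' _ _ ENNReal.ofNat_ne_top, lintegral_add_left hDm,
          lintegral_const_mul' _ _ (by finiteness)]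
    _ ≤ 2 * (kinetic α φ + ‖α‖ₑ ^ 2 * (N * (N * ((hardyConst α + 2 * N) * kinetic α φ)))) := by
        gcongr
        · exact lintegral_enorm_magneticDeriv_sq_le α φ j a
        · exact lintegral_enorm_vectorPotential_mul_sq_le hα' hφ j a
    _ = 2 * (1 + ‖α‖ₑ ^ 2 * (N * (N * (hardyConst α + 2 * N)))) * kinetic α φ := by ring

theorem isTest_zero : IsTest (0 : Config N → ℂ) :=
  ⟨contDiff_const, HasCompactSupport.zero, by simp [tsupport]⟩

theorem IsTest.sum {ι : Type*} (s : Finset ι) {φ : ι → Config N → ℂ} (h : ∀ i ∈ s, IsTest (φ i)) :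
    IsTest (∑ i ∈ s, φ i) :=
  Finset.sum_induction φ IsTest (fun _ _ => IsTest.add) isTest_zero h

/-- The core as a vector space. -/
def coreSpace (N : ℕ) : Submodule ℂ (Config N → ℂ) where
  carrier := {u | IsCore u}
  zero_mem' := ⟨isTest_zero.smooth, isTest_zero.compact, isTest_zero.support, fun _ _ => rfl⟩
  add_mem' {u v} hu hv := by
    obtain ⟨smooth, compact, support⟩ := hu.isTest.add hv.isTest
    exact ⟨smooth, compact, support, fun σ x => congrArg₂ (· + ·) (hu.symm σ x) (hv.symm σ x)⟩
  smul_mem' c u hu := by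
    obtain ⟨smooth, compact, support⟩ := hu.isTest.const_smul c
    exact ⟨smooth, compact, support, fun σ x => congrArg (c • ·) (hu.symm σ x)⟩

theorem isTest_coe (u : coreSpace N) : IsTest (u : Config N → ℂ) := IsCore.isTest u.2

/-- The square roots of the coefficients of the trap `V_ε`. -/
def trapCoeff (ε : ℝ) : Fin 2 → ℝ := ![1, ε⁻¹]

theorem trap_eq_sum (ε : ℝ) (v : Plane) : trap ε v = ∑ a, (trapCoeff ε a * v a) ^ 2 := by
  simp only [trap, trapCoeff, Fin.sum_univ_two, Matrix.cons_val_zero, Matrix.cons_val_one]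
  ring

theorem norm_sq_le_trap {ε : ℝ} (hε : ε ≠ 0) (v : Plane) :
    ‖v‖ ^ 2 ≤ (1 + ε ^ 2) * trap ε v := by
  have h : (1 + ε ^ 2) * trap ε v = ‖v‖ ^ 2 + (ε ^ 2 * v 0 ^ 2 + v 1 ^ 2 / ε ^ 2) := by
    rw [EuclideanSpace.real_norm_sq_eq, Fin.sum_univ_two, trap]
    field_simp
    ring
  rw [h]
  exact le_add_of_nonneg_right (by positivity)

/-- The components of the form norm: the function itself, its magnetic derivatives, and its
products with the coordinates. -/
abbrev FormIndex (N : ℕ) : Type := Option ((Fin N × Fin 2) ⊕ (Fin N × Fin 2))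

/-- The symmetric operators `T_i` with `H + 1 = ∑_i T_i²`: the identity, the components of the
`D_j`, and the multiplications by the coordinates, scaled as in the trap. -/
def formOp (α ε : ℝ) : FormIndex N → (Config N → ℂ) → Config N → ℂ
  | none, φ => φ
  | some (.inl (j, a)), φ => magneticDeriv α j a φ
  | some (.inr (j, a)), φ => fun x => ((trapCoeff ε a * x j a : ℝ) : ℂ) * φ x

theorem IsTest.formOp {φ : Config N → ℂ} (hφ : IsTest φ) (α ε : ℝ) :
    ∀ i, IsTest (formOp α ε i φ)
  | none => hφ
  | some (.inl (j, a)) => hφ.magneticDeriv α j a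
  | some (.inr (j, a)) => hφ.ofReal_mul fun _ _ =>
      contDiffAt_const.mul (contDiff_coord j a).contDiffAt

theorem formOp_add {φ ψ : Config N → ℂ} (hφ : IsTest φ) (hψ : IsTest ψ) (α ε : ℝ) :
    ∀ i, formOp α ε i (φ + ψ) = formOp α ε i φ + formOp α ε i ψ
  | none => rfl
  | some (.inl (j, a)) => magneticDeriv_add hφ hψ α j a
  | some (.inr _) => funext fun _ => mul_add _ _ _

theorem formOp_const_smul {φ : Config N → ℂ} (hφ : IsTest φ) (c : ℂ) (α ε : ℝ) :
    ∀ i, formOp α ε i (c • φ) = c • formOp α ε i φ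
  | none => rfl
  | some (.inl (j, a)) => magneticDeriv_const_smul hφ c α j a
  | some (.inr _) => funext fun _ => mul_left_comm _ _ _

theorem IsTest.integral_conj_formOp {φ ψ : Config N → ℂ} (hφ : IsTest φ) (hψ : IsTest ψ)
    (α ε : ℝ) : ∀ i, ∫ x, conj (Anyon.formOp α ε i φ x) * ψ x =
      ∫ x, conj (φ x) * Anyon.formOp α ε i ψ x
  | none => rfl
  | some (.inl (j, a)) => hφ.integral_conj_magneticDeriv hψ α j a
  | some (.inr _) => by simp only [Anyon.formOp, map_mul, Complex.conj_ofReal, mul_left_comm,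
      mul_assoc]

theorem hamiltonian_eq (α ε : ℝ) (φ : Config N → ℂ) :
    hamiltonian α ε φ = ∑ i, formOp α ε (some i) (formOp α ε (some i) φ) := by
  funext x
  have htrap (j : Fin N) : (trap ε (x j) : ℂ) * φ x =
      ∑ a, formOp α ε (some (.inr (j, a))) (formOp α ε (some (.inr (j, a))) φ) x := by
    simp only [formOp, trap_eq_sum, Complex.ofReal_sum, Finset.sum_mul]
    refine Finset.sum_congr rfl fun a _ => ?_
    push_cast
    ring
  simp only [hamiltonian, htrap, Finset.sum_apply, Finset.sum_add_distrib, Fintype.sum_sum_type,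
    Fintype.sum_prod_type, formOp]

theorem IsTest.hamiltonian {φ : Config N → ℂ} (hφ : IsTest φ) (α ε : ℝ) :
    IsTest (hamiltonian α ε φ) := by
  rw [hamiltonian_eq]
  exact IsTest.sum _ fun i _ => (hφ.formOp α ε i).formOp α ε i

theorem trap_mul_norm_sq (α ε : ℝ) (φ : Config N → ℂ) (j : Fin N) (x : Config N) :
    trap ε (x j) * ‖φ x‖ ^ 2 = ∑ a, ‖formOp α ε (some (.inr (j, a))) φ x‖ ^ 2 := by
  simp only [formOp, norm_mul _ (φ x), Complex.norm_real, mul_pow _ ‖φ x‖, Real.norm_eq_abs, sq_abs,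
    ← Finset.sum_mul, trap_eq_sum]

theorem IsTest.energy_eq {φ : Config N → ℂ} (hφ : IsTest φ) (α ε : ℝ) :
    energy α ε φ = ∑ i, ∫ x, ‖Anyon.formOp α ε (some i) φ x‖ ^ 2 := by
  have hD (j a) := (hφ.magneticDeriv α j a).integrable_norm_sq
  have hX (j a) := (hφ.formOp α ε (some (.inr (j, a)))).integrable_norm_sq
  simp only [energy, trap_mul_norm_sq α]
  rw [Fintype.sum_sum_type, Fintype.sum_prod_type, Fintype.sum_prod_type, ← Finset.sum_add_distrib]
  refine Finset.sum_congr rfl fun j _ => ?_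
  rw [integral_add (integrable_finsetSum _ fun a _ => hD j a)
    (integrable_finsetSum _ fun a _ => hX j a), integral_finsetSum _ fun a _ => hD j a,
    integral_finsetSum _ fun a _ => hX j a]
  rfl

theorem inner_toLp_right (f : L2 N) {v : Config N → ℂ} (hv : MemLp v 2 volume) :
    inner ℂ f (hv.toLp v) = ∫ x, conj (f x) * v x := by
  rw [L2.inner_def]
  refine integral_congr_ae ?_
  filter_upwards [hv.coeFn_toLp] with x hx
  rw [hx, RCLike.inner_apply, mul_comm]

theorem inner_toLp_toLp {u v : Config N → ℂ} (hu : MemLp u 2 volume) (hv : MemLp v 2 volume) :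
    inner ℂ (hu.toLp u) (hv.toLp v) = ∫ x, conj (u x) * v x := by
  rw [inner_toLp_right]
  refine integral_congr_ae ?_
  filter_upwards [hu.coeFn_toLp] with x hx
  rw [hx]

theorem IsTest.norm_toLp_sq {φ : Config N → ℂ} (hφ : IsTest φ) :
    ‖hφ.memLp.toLp φ‖ ^ 2 = ∫ x, ‖φ x‖ ^ 2 := by
  have h := inner_self_eq_norm_sq_to_K (𝕜 := ℂ) (hφ.memLp.toLp φ)
  rw [inner_toLp_toLp] at h
  simp only [Complex.conj_mul'] at h
  rw [← Complex.ofReal_inj, ← integral_complex_ofReal]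
  push_cast
  exact h.symm

/-- The Hilbert space in which the form norm is the norm: one copy of `L²` per component. -/
abbrev FormSpace (N : ℕ) : Type := PiLp 2 (fun _ : FormIndex N => L2 N)

/-- The embedding `u ↦ (T_i u)_i` of the core into the form space. -/
def formEmbed (α ε : ℝ) : coreSpace N →ₗ[ℂ] FormSpace N where
  toFun u := WithLp.toLp 2 fun i => ((isTest_coe u).formOp α ε i).memLp.toLp _
  map_add' u v := by
    ext1 i
    simp only [PiLp.add_apply, ← MemLp.toLp_add]
    exact MemLp.toLp_congr _ _ <| .of_eq <| formOp_add (isTest_coe u) (isTest_coe v) α ε i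
  map_smul' c u := by
    ext1 i
    simp only [PiLp.smul_apply, RingHom.id_apply, ← MemLp.toLp_const_smul]
    exact MemLp.toLp_congr _ _ <| .of_eq <| formOp_const_smul (isTest_coe u) c α ε i

theorem formEmbed_apply (α ε : ℝ) (u : coreSpace N) (i : FormIndex N) :
    formEmbed α ε u i = ((isTest_coe u).formOp α ε i).memLp.toLp _ := rfl

theorem norm_formEmbed_sq (α ε : ℝ) (u : coreSpace N) :
    ‖formEmbed α ε u‖ ^ 2 = ‖formEmbed α ε u none‖ ^ 2 + energy α ε (u : Config N → ℂ) := by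
  rw [PiLp.norm_sq_eq_of_L2, Fintype.sum_option, (isTest_coe u).energy_eq]
  exact congrArg _ <| Finset.sum_congr rfl fun i _ =>
    ((isTest_coe u).formOp α ε (some i)).norm_toLp_sq

theorem energy_le_norm_formEmbed_sq (α ε : ℝ) (u : coreSpace N) :
    energy α ε (u : Config N → ℂ) ≤ ‖formEmbed α ε u‖ ^ 2 := by
  rw [norm_formEmbed_sq]
  exact le_add_of_nonneg_left (by positivity)

theorem inner_formEmbed_formEmbed (α ε : ℝ) (u v : coreSpace N) :
    inner ℂ (formEmbed α ε u) (formEmbed α ε v) =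
      inner ℂ (formEmbed α ε u none) (((isTest_coe v).hamiltonian α ε).memLp.toLp _) +
        inner ℂ (formEmbed α ε u none) (formEmbed α ε v none) := by
  have hu := isTest_coe u
  have hv (i) := (isTest_coe v).formOp α ε i
  rw [PiLp.inner_apply, Fintype.sum_option, add_comm]
  congr 1
  simp only [formEmbed_apply, inner_toLp_toLp, hu.integral_conj_formOp (hv _)]
  rw [← integral_finsetSum _ fun i _ => hu.integrable_conj_mul ((hv (some i)).formOp α ε _)]
  simp only [hamiltonian_eq, Finset.sum_apply, Finset.mul_sum, formOp]

/-- The closure of the graph of the form: its elements are the families `(T_i φ)_i` for `φ` in the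
form domain. -/
abbrev formClosure (N : ℕ) (α ε : ℝ) : Submodule ℂ (FormSpace N) :=
  (LinearMap.range (formEmbed (N := N) α ε)).topologicalClosure

/-- The component `φ` of `(T_i φ)_i`. -/
def formProj (N : ℕ) : FormSpace N →L[ℂ] L2 N :=
  PiLp.proj 2 (fun _ : FormIndex N => L2 N) none

theorem formClosure_induction {α ε : ℝ} {P : FormSpace N → Prop} (hP : IsClosed {p | P p})
    (h : ∀ u, P (formEmbed α ε u)) {p : FormSpace N} (hp : p ∈ formClosure N α ε) : P p :=
  closure_minimal (t := {p | P p}) (Set.range_subset_iff.2 h) hP hp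

theorem inner_formClosure {α ε : ℝ} {p : FormSpace N} (hp : p ∈ formClosure N α ε)
    (v : coreSpace N) : inner ℂ p (formEmbed α ε v) =
      inner ℂ (formProj N p) (((isTest_coe v).hamiltonian α ε).memLp.toLp _) +
        inner ℂ (formProj N p) (formEmbed α ε v none) :=
  formClosure_induction (P := fun p => inner ℂ p (formEmbed α ε v) =
      inner ℂ (formProj N p) (((isTest_coe v).hamiltonian α ε).memLp.toLp _) +
        inner ℂ (formProj N p) (formEmbed α ε v none))
    (isClosed_eq (by fun_prop) (by fun_prop)) (fun u => inner_formEmbed_formEmbed α ε u v) hp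

theorem isClosed_L2sym : IsClosed (L2sym N : Set (L2 N)) := by
  have hinter : (L2sym N : Set (L2 N)) = ⋂ σ : Equiv.Perm (Fin N),
      {φ | Lp.compMeasurePreserving _ (measurePreserving_perm σ) φ = φ} := by
    ext φ
    simp only [Set.mem_iInter, Set.mem_ofPred_eq]
    refine forall_congr' fun σ => ?_
    have h := Lp.coeFn_compMeasurePreserving φ (measurePreserving_perm σ)
    exact ⟨fun hσ => Lp.ext (h.trans hσ), fun hσ => h.symm.trans (.of_eq (by rw [hσ]))⟩
  rw [hinter]
  exact isClosed_iInter fun σ => isClosed_eq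
    (Lp.isometry_compMeasurePreserving (measurePreserving_perm σ)).continuous continuous_id

theorem formProj_mem_L2sym {α ε : ℝ} {p : FormSpace N} (hp : p ∈ formClosure N α ε) :
    formProj N p ∈ L2sym N := by
  refine formClosure_induction (P := fun p => formProj N p ∈ L2sym N)
    (isClosed_L2sym.preimage (formProj N).continuous) (fun u σ => ?_) hp
  have h := (isTest_coe u).memLp.coeFn_toLp
  filter_upwards [h, (measurePreserving_perm σ).quasiMeasurePreserving.ae_eq_comp h] with x h1 h2
  exact (h2.trans (IsCore.symm u.2 σ x)).trans h1.symm

theorem tendsto_formEmbed_none_iff {α ε : ℝ} {u : ℕ → coreSpace N} {φ : L2 N} :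
    Tendsto (fun n => formProj N (formEmbed α ε (u n))) atTop (𝓝 φ) ↔
      Tendsto (fun n => eLpNorm (fun x => (u n : Config N → ℂ) x - φ x) 2 volume) atTop (𝓝 0) := by
  have h := Lp.tendsto_Lp_iff_tendsto_eLpNorm'' (fun n => (u n : Config N → ℂ))
    (fun n => (isTest_coe (u n)).memLp) φ (Lp.memLp φ) (fi := atTop)
  rwa [Lp.toLp_coeFn] at h

theorem cauchySeq_formEmbed_iff {α ε : ℝ} {u : ℕ → coreSpace N} :
    CauchySeq (fun n => formEmbed α ε (u n)) ↔
      CauchySeq (fun n => formProj N (formEmbed α ε (u n))) ∧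
        ∀ δ > 0, ∃ n₀, ∀ m ≥ n₀, ∀ n ≥ n₀,
          energy α ε ((u m - u n : coreSpace N) : Config N → ℂ) < δ := by
  have hsplit (m n : ℕ) : dist (formEmbed α ε (u m)) (formEmbed α ε (u n)) ^ 2 =
      dist (formProj N (formEmbed α ε (u m))) (formProj N (formEmbed α ε (u n))) ^ 2 +
        energy α ε ((u m - u n : coreSpace N) : Config N → ℂ) := by
    rw [dist_eq_norm, dist_eq_norm, ← map_sub, ← map_sub, norm_formEmbed_sq]
    rfl
  refine ⟨fun h => ⟨h.map (formProj N).uniformContinuous, fun δ hδ => ?_⟩, fun ⟨hL, hE⟩ => ?_⟩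
  · obtain ⟨n₀, hn₀⟩ := Metric.cauchySeq_iff.1 h √δ (Real.sqrt_pos.2 hδ)
    refine ⟨n₀, fun m hm n hn => ?_⟩
    have hlt := pow_lt_pow_left₀ (hn₀ m hm n hn) dist_nonneg two_ne_zero
    rw [Real.sq_sqrt hδ.le, hsplit] at hlt
    exact (le_add_of_nonneg_left (sq_nonneg _)).trans_lt hlt
  · refine Metric.cauchySeq_iff.2 fun r hr => ?_
    obtain ⟨n₁, hn₁⟩ := hE (r ^ 2 / 2) (by positivity)
    obtain ⟨n₂, hn₂⟩ := Metric.cauchySeq_iff.1 hL (r / 2) (by positivity)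
    refine ⟨max n₁ n₂, fun m hm n hn => lt_of_pow_lt_pow_left₀ 2 hr.le ?_⟩
    have hlt := pow_lt_pow_left₀ (hn₂ m (le_of_max_le_right hm) n (le_of_max_le_right hn))
      dist_nonneg two_ne_zero
    have := hn₁ m (le_of_max_le_left hm) n (le_of_max_le_left hn)
    rw [hsplit]
    linarith [sq_pos_of_pos hr]

theorem mem_formDomain_iff_exists_seq {α ε : ℝ} {φ : L2 N} :
    φ ∈ formDomain N α ε ↔ ∃ u : ℕ → coreSpace N, CauchySeq (fun n => formEmbed α ε (u n)) ∧
      Tendsto (fun n => formProj N (formEmbed α ε (u n))) atTop (𝓝 φ) := by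
  constructor
  · rintro ⟨u, hu, hE, hL⟩
    have hL' := tendsto_formEmbed_none_iff (α := α) (ε := ε) (u := fun n => ⟨u n, hu n⟩).2 hL
    exact ⟨_, cauchySeq_formEmbed_iff.2 ⟨hL'.cauchySeq, hE⟩, hL'⟩
  · rintro ⟨u, hu, hL⟩
    exact ⟨fun n => u n, fun n => (u n).2, (cauchySeq_formEmbed_iff.1 hu).2,
      tendsto_formEmbed_none_iff.1 hL⟩

theorem formDomain_eq_image (N : ℕ) (α ε : ℝ) :
    formDomain N α ε = formProj N '' (formClosure N α ε : Set (FormSpace N)) := by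
  ext φ
  rw [mem_formDomain_iff_exists_seq]
  constructor
  · rintro ⟨u, hu, hL⟩
    obtain ⟨p, hp⟩ := cauchySeq_tendsto_of_complete hu
    exact ⟨p, mem_closure_of_tendsto hp (.of_forall fun n => LinearMap.mem_range_self _ (u n)),
      tendsto_nhds_unique (((formProj N).continuous.tendsto p).comp hp) hL⟩
  · rintro ⟨p, hp, rfl⟩
    obtain ⟨y, hy, hlim⟩ := mem_closure_iff_seq_limit.1 hp
    choose u hu using hy
    obtain rfl : (fun n => formEmbed α ε (u n)) = y := funext hu
    exact ⟨u, hlim.cauchySeq, ((formProj N).continuous.tendsto p).comp hlim⟩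

/-- The inverse of `H + 1` on `L²_sym`, as given by the Riesz representation theorem: `f` is mapped
to the `L²` component of the element of the form closure that represents `⟨f, ·⟩`. -/
def friedrichsResolvent (N : ℕ) (α ε : ℝ) : L2sym N →L[ℂ] L2sym N :=
  ((formProj N ∘L (formClosure N α ε).starProjection ∘L ContinuousLinearMap.adjoint (formProj N)) ∘L
    (L2sym N).subtypeL).codRestrict (L2sym N) fun _ =>
      formProj_mem_L2sym (Submodule.starProjection_apply_mem _ _)

theorem mem_friedrichsGraph_iff {α ε : ℝ} {φ f : L2sym N} :
    (φ, f - φ) ∈ friedrichsGraph N α ε ↔ (φ : L2 N) ∈ formDomain N α ε ∧ ∀ v : coreSpace N,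
      inner ℂ (φ : L2 N) (((isTest_coe v).hamiltonian α ε).memLp.toLp _) +
        inner ℂ (φ : L2 N) (formEmbed α ε v none) = inner ℂ (f : L2 N) (formEmbed α ε v none) := by
  refine and_congr_right fun _ => ⟨fun h v => ?_, fun h v hv => ?_⟩
  · have hv := h v v.2
    rwa [← inner_toLp_right _ ((isTest_coe v).hamiltonian α ε).memLp,
      ← inner_toLp_right _ (isTest_coe v).memLp, Submodule.coe_sub, inner_sub_left,
      eq_sub_iff_add_eq] at hv
  · rw [← inner_toLp_right _ (hv.isTest.hamiltonian α ε).memLp,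
      ← inner_toLp_right _ hv.isTest.memLp, Submodule.coe_sub, inner_sub_left, eq_sub_iff_add_eq]
    exact h ⟨v, hv⟩

theorem isResolventAtNegOne_friedrichsResolvent (N : ℕ) (α ε : ℝ) :
    IsResolventAtNegOne (friedrichsGraph N α ε) (friedrichsResolvent N α ε) := by
  intro φ f
  have hiff :=
    eq_starProjection_adjoint_iff (LinearMap.range (formEmbed α ε)) (formProj N) (f : L2 N)
  rw [mem_friedrichsGraph_iff, formDomain_eq_image]
  constructor
  · rintro ⟨⟨p, hp, hpφ⟩, h⟩
    refine Subtype.ext <| hpφ.symm.trans <| congrArg (formProj N) <| (hiff p).2 ⟨hp, ?_⟩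
    rintro _ ⟨v, rfl⟩
    rw [inner_formClosure hp, hpφ, h v]
    rfl
  · rintro rfl
    obtain ⟨hp, h⟩ := (hiff _).1 rfl
    exact ⟨⟨_, hp, rfl⟩, fun v => (inner_formClosure hp v).symm.trans (h _ ⟨v, rfl⟩)⟩

theorem lintegral_enorm_sq_formOp_le (α ε : ℝ) (u : coreSpace N) :
    ∑ i, ∫⁻ x, ‖formOp α ε (some i) (u : Config N → ℂ) x‖ₑ ^ 2 ≤ ‖formEmbed α ε u‖ₑ ^ 2 := by
  have h (i) := (isTest_coe u).formOp α ε i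
  rw [← ofReal_norm, ← ENNReal.ofReal_pow (norm_nonneg _)]
  simp only [(h _).lintegral_enorm_sq]
  rw [← ENNReal.ofReal_sum_of_nonneg fun i _ => by positivity, ← (isTest_coe u).energy_eq]
  exact ENNReal.ofReal_le_ofReal (energy_le_norm_formEmbed_sq α ε u)

theorem kinetic_le (α ε : ℝ) (u : coreSpace N) :
    kinetic α (u : Config N → ℂ) ≤ ‖formEmbed α ε u‖ₑ ^ 2 := by
  refine le_trans ?_ (lintegral_enorm_sq_formOp_le α ε u)
  rw [(isTest_coe u).kinetic_eq, Fintype.sum_sum_type, Fintype.sum_prod_type,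
    ENNReal.ofReal_sum_of_nonneg fun j _ => by positivity]
  refine le_add_of_le_left (Finset.sum_le_sum fun j _ => ?_)
  rw [ENNReal.ofReal_sum_of_nonneg fun a _ => by positivity]
  exact Finset.sum_le_sum fun a _ => ((isTest_coe u).magneticDeriv α j a).lintegral_enorm_sq.ge

theorem norm_sq_mul_norm_sq_le (α : ℝ) {ε : ℝ} (hε : ε ≠ 0) (φ : Config N → ℂ) (j : Fin N)
    (x : Config N) : ‖x j‖ ^ 2 * ‖φ x‖ ^ 2 ≤
      (1 + ε ^ 2) * ∑ a, ‖formOp α ε (some (.inr (j, a))) φ x‖ ^ 2 := by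
  rw [← trap_mul_norm_sq, ← mul_assoc]
  exact mul_le_mul_of_nonneg_right (norm_sq_le_trap hε (x j)) (sq_nonneg _)

theorem lintegral_enorm_sq_mul_le (α : ℝ) {ε : ℝ} (hε : ε ≠ 0) (u : coreSpace N) :
    ∫⁻ x, ‖x‖ₑ ^ 2 * ‖(u : Config N → ℂ) x‖ₑ ^ 2 ≤
      ENNReal.ofReal (1 + ε ^ 2) * ‖formEmbed α ε u‖ₑ ^ 2 := by
  have hmeas (i) := ((isTest_coe u).formOp α ε i).continuous.measurable.enorm.pow_const 2
  have hpoint (x : Config N) : ‖x‖ₑ ^ 2 * ‖(u : Config N → ℂ) x‖ₑ ^ 2 ≤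
      ENNReal.ofReal (1 + ε ^ 2) * ∑ i, ‖formOp α ε (some i) (u : Config N → ℂ) x‖ₑ ^ 2 := by
    simp only [← ofReal_norm, ← ENNReal.ofReal_pow (norm_nonneg _)]
    rw [← ENNReal.ofReal_mul (by positivity),
      ← ENNReal.ofReal_sum_of_nonneg fun i _ => by positivity,
      ← ENNReal.ofReal_mul (by positivity), Fintype.sum_sum_type, mul_add, Fintype.sum_prod_type,
      Fintype.sum_prod_type]
    refine ENNReal.ofReal_le_ofReal <| le_add_of_nonneg_of_le (by positivity) ?_
    refine (mul_le_mul_of_nonneg_right (pi_norm_sq_le_sum x) (sq_nonneg _)).trans ?_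
    rw [Finset.sum_mul, Finset.mul_sum]
    exact Finset.sum_le_sum fun j _ => norm_sq_mul_norm_sq_le α hε _ j x
  refine (lintegral_mono hpoint).trans ?_
  rw [lintegral_const_mul _ (Finset.measurable_sum _ fun i _ => hmeas (some i)),
    lintegral_finsetSum _ fun i _ => hmeas (some i)]
  gcongr
  exact lintegral_enorm_sq_formOp_le α ε u

theorem eq_sum_smul_unitVec (v : Config N) :
    v = ∑ p : Fin N × Fin 2, v p.1 p.2 • unitVec p.1 p.2 := by
  have hplane (w : Plane) : w = ∑ a, w a • EuclideanSpace.single a (1 : ℝ) := by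
    simpa using ((EuclideanSpace.basisFun (Fin 2) ℝ).sum_repr w).symm
  rw [Fintype.sum_prod_type]
  calc v = ∑ j, Pi.single j (v j) := (Finset.univ_sum_single v).symm
    _ = ∑ j, ∑ a, v j a • unitVec j a := by
        refine Finset.sum_congr rfl fun j _ => ?_
        simp only [unitVec, ← Pi.single_smul]
        conv_lhs => rw [hplane (v j)]
        exact map_sum (LinearMap.single ℝ (fun _ => Plane) j) _ _

theorem enorm_fderiv_sq_le (φ : Config N → ℂ) (x : Config N) : ‖fderiv ℝ φ x‖ₑ ^ 2 ≤
    Fintype.card (Fin N × Fin 2) * ∑ p : Fin N × Fin 2, ‖partialDeriv p.1 p.2 φ x‖ₑ ^ 2 := by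
  have hnorm : ‖fderiv ℝ φ x‖ ≤ ∑ p : Fin N × Fin 2, ‖partialDeriv p.1 p.2 φ x‖ := by
    refine ContinuousLinearMap.opNorm_le_bound _ (by positivity) fun v => ?_
    conv_lhs => rw [eq_sum_smul_unitVec v, map_sum]
    rw [Finset.sum_mul]
    refine norm_sum_le_of_le _ fun p _ => ?_
    rw [map_smul, norm_smul, mul_comm]
    exact mul_le_mul_of_nonneg_left
      ((PiLp.norm_apply_le (v p.1) p.2).trans (norm_le_pi_norm v p.1)) (norm_nonneg _)
  have henorm : ‖fderiv ℝ φ x‖ₑ ≤ ∑ p : Fin N × Fin 2, ‖partialDeriv p.1 p.2 φ x‖ₑ := by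
    simp only [← ofReal_norm]
    rw [← ENNReal.ofReal_sum_of_nonneg fun p _ => norm_nonneg _]
    exact ENNReal.ofReal_le_ofReal hnorm
  exact (pow_le_pow_left' henorm 2).trans (sq_sum_le _ _)

theorem exists_lintegral_enorm_fderiv_sq_add_le (N : ℕ) {α ε : ℝ}
    (hα : ∀ q : ℤ, q ≠ 0 → α ≠ 2 * (q : ℝ)) (hε : ε ≠ 0) :
    ∃ C : NNReal, ∀ u : coreSpace N, (∫⁻ x, ‖fderiv ℝ (u : Config N → ℂ) x‖ₑ ^ 2) +
      ∫⁻ x, ‖x‖ₑ ^ 2 * ‖(u : Config N → ℂ) x‖ₑ ^ 2 ≤ C * ‖formEmbed α ε u‖ₑ ^ 2 := by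
  obtain ⟨C, hC, hgrad⟩ := exists_lintegral_enorm_partialDeriv_sq_le N hα
  lift C to NNReal using hC
  set n := Fintype.card (Fin N × Fin 2)
  refine ⟨n * (n * C) + (1 + ε ^ 2).toNNReal, fun u => ?_⟩
  push_cast
  rw [add_mul]
  refine add_le_add ?_ (lintegral_enorm_sq_mul_le α hε u)
  have hmeas (p : Fin N × Fin 2) :=
    ((isTest_coe u).partialDeriv p.1 p.2).continuous.measurable.enorm.pow_const 2
  calc ∫⁻ x, ‖fderiv ℝ (u : Config N → ℂ) x‖ₑ ^ 2
      ≤ ∫⁻ x, n * ∑ p : Fin N × Fin 2, ‖partialDeriv p.1 p.2 (u : Config N → ℂ) x‖ₑ ^ 2 :=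
        lintegral_mono fun x => enorm_fderiv_sq_le _ x
    _ = n * ∑ p : Fin N × Fin 2, ∫⁻ x, ‖partialDeriv p.1 p.2 (u : Config N → ℂ) x‖ₑ ^ 2 := by
        rw [lintegral_const_mul _ (Finset.measurable_sum _ fun p _ => hmeas p),
          lintegral_finsetSum _ fun p _ => hmeas p]
    _ ≤ n * ∑ _p : Fin N × Fin 2, C * kinetic α (u : Config N → ℂ) := by
        gcongr with p
        exact hgrad u u.2 p.1 p.2
    _ = n * (n * C) * kinetic α (u : Config N → ℂ) := by
        rw [Finset.sum_const, Finset.card_univ, nsmul_eq_mul, mul_assoc, mul_assoc]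
    _ ≤ n * (n * C) * ‖formEmbed α ε u‖ₑ ^ 2 := by
        gcongr
        exact kinetic_le α ε u

theorem exists_finiteDimensional_infDist_formEmbed_le {α ε : ℝ}
    (hα : ∀ q : ℤ, q ≠ 0 → α ≠ 2 * (q : ℝ)) (hε : ε ≠ 0) {η : ℝ} (hη : 0 < η) :
    ∃ V : Submodule ℂ (L2 N), FiniteDimensional ℂ V ∧ ∀ u : coreSpace N,
      Metric.infDist (formProj N (formEmbed α ε u)) V ≤ η * ‖formEmbed α ε u‖ := by
  obtain ⟨C, hC⟩ := exists_lintegral_enorm_fderiv_sq_add_le N hα hε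
  lift η to NNReal using hη.le
  have hη' : η ^ 2 / (C + 1) ≠ 0 :=
    div_ne_zero (pow_ne_zero 2 (by exact_mod_cast hη.ne')) (by positivity)
  obtain ⟨V, hV, happrox⟩ := exists_finiteDimensional_enorm_sub_sq_le ℂ
    (volume : Measure (Config N)) hη'
  refine ⟨V, hV, fun u => ?_⟩
  obtain ⟨w, hwV, hw⟩ := happrox u ((isTest_coe u).smooth.of_le (by simp)) (isTest_coe u).memLp
  refine (Metric.infDist_le_dist_of_mem hwV).trans ?_
  rw [dist_eq_norm]
  refine norm_le_mul_norm_of_enorm_sq_le ?_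
  calc ‖formProj N (formEmbed α ε u) - w‖ₑ ^ 2
      ≤ (η ^ 2 / (C + 1) : NNReal) * (C * ‖formEmbed α ε u‖ₑ ^ 2) :=
        hw.trans (by gcongr; exact hC u)
    _ = (η ^ 2 / (C + 1) * C : NNReal) * ‖formEmbed α ε u‖ₑ ^ 2 := by push_cast; ring
    _ ≤ (η ^ 2 : NNReal) * ‖formEmbed α ε u‖ₑ ^ 2 := by
        gcongr
        rw [div_mul_eq_mul_div, div_le_iff₀ (by positivity)]
        gcongr
        exact le_self_add
    _ = (η * ‖formEmbed α ε u‖ₑ) ^ 2 := by push_cast; ring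

theorem isCompactOperator_friedrichsResolvent {α ε : ℝ} (hα : ∀ q : ℤ, q ≠ 0 → α ≠ 2 * (q : ℝ))
    (hε : ε ≠ 0) : IsCompactOperator (friedrichsResolvent N α ε) := by
  have hcompact : IsCompactOperator (formProj N ∘L (formClosure N α ε).starProjection) := by
    refine isCompactOperator_comp_starProjection _ _ fun η hη => ?_
    obtain ⟨V, hV, hle⟩ := exists_finiteDimensional_infDist_formEmbed_le (N := N) hα hε hη
    exact ⟨V, hV, by rintro _ ⟨u, rfl⟩; exact hle u⟩
  exact IsCompactOperator.codRestrict (hcompact.comp_clm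
    (ContinuousLinearMap.adjoint (formProj N) ∘L (L2sym N).subtypeL)) _ isClosed_L2sym

theorem integral_mul_eq_conj_inner (f : L2 N) {ψ : Config N → ℂ}
    (hψ : MemLp (fun x => conj (ψ x)) 2 volume) :
    ∫ x, f x * ψ x = conj (inner ℂ f (hψ.toLp _)) := by
  rw [inner_toLp_right, ← integral_conj]
  simp only [map_mul, Complex.conj_conj]

theorem continuous_integral_mul {ψ : Config N → ℂ} (hψ : Continuous ψ)
    (hs : HasCompactSupport ψ) : Continuous fun f : L2 N => ∫ x, f x * ψ x := by
  have hψ' : MemLp (fun x => conj (ψ x)) 2 (volume : Measure (Config N)) :=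
    (Complex.continuous_conj.comp hψ).memLp_of_hasCompactSupport (hs.comp_left (map_zero _))
  simp only [integral_mul_eq_conj_inner _ hψ']
  fun_prop

theorem isClosed_setOf_isWeakPartial (j : Fin N) (a : Fin 2) :
    IsClosed {q : L2 N × L2 N | IsWeakPartial j a q.1 q.2} := by
  have hinter : {q : L2 N × L2 N | IsWeakPartial j a q.1 q.2} =
      ⋂ (ψ : Config N → ℂ) (_ : ContDiff ℝ ∞ ψ) (_ : HasCompactSupport ψ),
        {q | ∫ x, q.1 x * partialDeriv j a ψ x = -∫ x, q.2 x * ψ x} := by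
    ext q
    simp only [IsWeakPartial, Set.mem_iInter, Set.mem_ofPred_eq]
  rw [hinter]
  refine isClosed_iInter fun ψ => isClosed_iInter fun hψ => isClosed_iInter fun hs => ?_
  have hψ' : Continuous (partialDeriv j a ψ) :=
    (hψ.continuous_fderiv (by simp)).clm_apply continuous_const
  exact isClosed_eq
    ((continuous_integral_mul hψ' (hs.fderiv_apply ℝ _)).comp continuous_fst)
    ((continuous_integral_mul hψ.continuous hs).comp continuous_snd).neg

/-- The classical partial derivative of core functions, as an operator into `L²`. -/
def corePartialDeriv (j : Fin N) (a : Fin 2) : coreSpace N →ₗ[ℂ] L2 N where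
  toFun u := ((isTest_coe u).partialDeriv j a).memLp.toLp _
  map_add' u v := by
    rw [← MemLp.toLp_add]
    exact MemLp.toLp_congr _ _ <| .of_eq <| partialDeriv_add (isTest_coe u) (isTest_coe v) j a
  map_smul' c u := by
    rw [RingHom.id_apply, ← MemLp.toLp_const_smul]
    exact MemLp.toLp_congr _ _ <| .of_eq <| partialDeriv_const_smul (isTest_coe u) c j a

theorem isWeakPartial_corePartialDeriv (α ε : ℝ) (j : Fin N) (a : Fin 2) (u : coreSpace N) :
    IsWeakPartial j a (formProj N (formEmbed α ε u)) (corePartialDeriv j a u) := by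
  intro ψ hψ _
  have hu := isTest_coe u
  calc ∫ x, formProj N (formEmbed α ε u) x * partialDeriv j a ψ x
      = ∫ x, (u : Config N → ℂ) x * partialDeriv j a ψ x :=
        integral_congr_ae (hu.memLp.coeFn_toLp.mul (.refl _ _))
    _ = -∫ x, partialDeriv j a (u : Config N → ℂ) x * ψ x := hu.integral_mul_partialDeriv hψ j a
    _ = -∫ x, corePartialDeriv j a u x * ψ x :=
        congrArg Neg.neg <| integral_congr_ae
          ((hu.partialDeriv j a).memLp.coeFn_toLp.symm.mul (.refl _ _))

theorem exists_norm_corePartialDeriv_le (N : ℕ) {α : ℝ} (hα : ∀ q : ℤ, q ≠ 0 → α ≠ 2 * (q : ℝ))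
    (ε : ℝ) : ∃ C : NNReal, ∀ (j : Fin N) (a : Fin 2) (u : coreSpace N),
      ‖corePartialDeriv j a u‖ ≤ C * ‖formEmbed α ε u‖ := by
  obtain ⟨C, hC, hgrad⟩ := exists_lintegral_enorm_partialDeriv_sq_le N hα
  lift C to NNReal using hC
  refine ⟨NNReal.sqrt C, fun j a u => ?_⟩
  refine norm_le_mul_norm_of_enorm_sq_le ?_
  calc ‖corePartialDeriv j a u‖ₑ ^ 2
      = ∫⁻ x, ‖partialDeriv j a (u : Config N → ℂ) x‖ₑ ^ 2 := by
        rw [← eLpNorm_two_sq, corePartialDeriv]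
        exact congrArg (· ^ 2) (Lp.enorm_toLp ((isTest_coe u).partialDeriv j a).memLp)
    _ ≤ C * ‖formEmbed α ε u‖ₑ ^ 2 :=
        (hgrad u u.2 j a).trans (by gcongr; exact kinetic_le α ε u)
    _ = (NNReal.sqrt C * ‖formEmbed α ε u‖ₑ) ^ 2 := by
        rw [mul_pow, ← ENNReal.coe_pow, NNReal.sq_sqrt]

theorem formDomain_subset_sobolevH1 {α : ℝ} (hα : ∀ q : ℤ, q ≠ 0 → α ≠ 2 * (q : ℝ)) (ε : ℝ) :
    formDomain N α ε ⊆ sobolevH1 N := by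
  intro φ hφ j a
  obtain ⟨u, hu, hlim⟩ := mem_formDomain_iff_exists_seq.1 hφ
  obtain ⟨C, hC⟩ := exists_norm_corePartialDeriv_le N hα ε
  have hcauchy : CauchySeq fun n => corePartialDeriv j a (u n) := by
    rw [cauchySeq_iff_tendsto_dist_atTop_0] at hu ⊢
    refine squeeze_zero (fun _ => dist_nonneg) (fun n => ?_) (by simpa using hu.const_mul (C : ℝ))
    rw [dist_eq_norm, dist_eq_norm, ← map_sub, ← map_sub]
    exact hC j a _
  obtain ⟨g, hg⟩ := cauchySeq_tendsto_of_complete hcauchy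
  exact ⟨g, (isClosed_setOf_isWeakPartial j a).mem_of_tendsto (hlim.prodMk_nhds hg)
    (.of_forall fun n => isWeakPartial_corePartialDeriv α ε j a (u n))⟩

theorem formClosure_apply_inr_ae_eq {α ε : ℝ} {p : FormSpace N} (hp : p ∈ formClosure N α ε)
    (j : Fin N) (a : Fin 2) :
    p (some (.inr (j, a))) =ᵐ[volume] formOp α ε (some (.inr (j, a))) (formProj N p) := by
  refine formClosure_induction
    (P := fun p => p (some (.inr (j, a))) =ᵐ[volume]
      formOp α ε (some (.inr (j, a))) (formProj N p)) ?_ (fun u => ?_) hp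
  · refine (isClosed_setOf_ae_eq_mul _).preimage
      (f := fun p : FormSpace N => (formProj N p, p (some (.inr (j, a))))) ?_
    fun_prop
  · have hu (i) := ((isTest_coe u).formOp α ε i).memLp.coeFn_toLp
    filter_upwards [hu none, hu (some (.inr (j, a)))] with x h₀ h₁
    exact h₁.trans (congrArg (((trapCoeff ε a * x j a : ℝ) : ℂ) * ·) h₀.symm)

theorem formDomain_subset_sobolevH1V {α ε : ℝ} (hα : ∀ q : ℤ, q ≠ 0 → α ≠ 2 * (q : ℝ))
    (hε : ε ≠ 0) : formDomain N α ε ⊆ sobolevH1V N := by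
  intro φ hφ
  refine ⟨formDomain_subset_sobolevH1 hα ε hφ, fun j => ?_⟩
  rw [formDomain_eq_image] at hφ
  obtain ⟨p, hp, rfl⟩ := hφ
  have hint (a : Fin 2) :
      Integrable fun x => ‖formOp α ε (some (.inr (j, a))) (formProj N p) x‖ ^ 2 :=
    ((Lp.memLp _).ae_eq (formClosure_apply_inr_ae_eq hp j a)).norm.integrable_sq
  have hmeas : AEStronglyMeasurable (fun x => (‖x j‖ : ℂ) * formProj N p x) volume := by
    have hcont : Continuous fun x : Config N => (‖x j‖ : ℂ) := by fun_prop
    exact hcont.aestronglyMeasurable.mul (Lp.aestronglyMeasurable _)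
  rw [memLp_two_iff_integrable_sq_norm hmeas]
  refine ((integrable_finsetSum Finset.univ fun a _ => hint a).const_mul (1 + ε ^ 2)).mono'
    (hmeas.norm.pow 2) (.of_forall fun x => ?_)
  rw [Real.norm_of_nonneg (sq_nonneg _), norm_mul, Complex.norm_real, norm_norm, mul_pow]
  exact norm_sq_mul_norm_sq_le α hε _ j x

end Anyon

end

theorem corollary2p4 (N : ℕ) (hN : 2 ≤ N) (α ε : ℝ)
    (hα : ∀ q : ℤ, q ≠ 0 → α ≠ 2 * (q : ℝ)) (hε : 0 < ε) :
    Anyon.formDomain N α ε ⊆ Anyon.sobolevH1V N ∧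
    ∃ R : Anyon.L2sym N →L[ℂ] Anyon.L2sym N,
      Anyon.IsResolventAtNegOne (Anyon.friedrichsGraph N α ε) R ∧ IsCompactOperator R :=
  ⟨Anyon.formDomain_subset_sobolevH1V hα hε.ne', Anyon.friedrichsResolvent N α ε,
    Anyon.isResolventAtNegOne_friedrichsResolvent N α ε,
    Anyon.isCompactOperator_friedrichsResolvent hα hε.ne'⟩
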